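/- Let $G$ be a connected complex reductive group (a connected linear algebraic group over $\mathbb{C}$ with trivial unipotent radical, regarded as a complex Lie group; semisimple and unipotent elements are defined through a faithful algebraic representation $G\subseteq GL_n(\mathbb{C})$). Let $\mathbb{A}=\mathbb{C}$ be the affine line, and let $\mathbb{C}\ltimes\mathbb{A}$ be the action groupoid with arrows $(\lambda,z)\colon z\to e^{\lambda}z$. A representation $(P,\Phi)$ of $\mathbb{C}\ltimes\mathbb{A}$ is a holomorphic principal (right) $G$-bundle $P\to\mathbb{A}$ with a holomorphic groupoid homomorphism $\Phi$ to the gauge groupoid of $P$, i.e. $G$-equivariant maps $\Phi(\lambda,z)\colon P_z\to P_{e^{\lambda}z}$, holomorphic in $(\lambda,z)$, with $\Phi(0,z)=\mathrm{id}$ and $\Phi(\mu,e^{\lambda}z)\Phi(\lambda,z)=\Phi(\mu+\lambda,z)$. Morphisms are holomorphic $G$-equivariant maps of bundles over $\mathrm{id}_{\mathbb{A}}$ that intertwine the representations. This is the category $\mathrm{Rep}(\mathbb{C}\ltimes\mathbb{A},G)$. The monodromy of $(P,\Phi)$ is $M(z)=\Phi(2\pi i,z)\in\mathrm{Aut}_G(P_z)\cong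 G$; it is semisimple if $M(z)$ is semisimple for all $z\neq 0$. Write $M(z)=M_s(z)M_u(z)$ for the multiplicative Jordan-Chevalley decomposition, $z\in\mathbb{A}$. A $1$-cocycle valued in $(P,\Phi)$ is a holomorphic family $\sigma(\lambda,z)\in\mathrm{Aut}_G(P_{e^{\lambda}z})$ with $\sigma(\mu,e^{\lambda}z)\,\Phi(\mu,e^{\lambda}z)\,\sigma(\lambda,z)=\sigma(\mu+\lambda,z)\,\Phi(\mu,e^{\lambda}z)$; then $(\sigma\circ\Phi)(\lambda,z)=\sigma(\lambda,z)\Phi(\lambda,z)$ is again a representation on $P$. Let $\mathcal{JC}$ be the category whose objects are triples $(P,\Psi,U)$, where $\Psi$ is a representation on $P$ with semisimple monodromy and $U$ is a unipotent automorphism of $(P,\Psi)$ (that is, $U(z)\in\mathrm{Aut}_G(P_z)$ is unipotent for every $z$), and whose morphisms are the morphisms of representations that intertwine the automorphisms $U$. Theorem. There is an isomorphism of categories $D\colon\mathrm{Rep}(\mathbb{C}\ltimes\mathbb{A},G)\to\mathcal{JC}$, which sends $(P,\Phi)$ to $(P,\sigma_\Phi\circ\Phi,M_u)$, where $\sigma_\Phi$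 is the $1$-cocycle $$\sigma_\Phi(\lambda,z)=\exp\Big(\frac{-\lambda}{2\pi i}\log M_u(e^{\lambda}z)\Big),$$ and which is the identity on morphisms (as maps of principal bundles). Its inverse sends $(P,\Psi,U)$ to $(P,\tau_U\circ\Psi)$, where $\tau_U$ is the $1$-cocycle valued in $(P,\Psi)$ given by $$\tau_U(\lambda,z)=\exp\Big(\frac{\lambda}{2\pi i}\log U(e^{\lambda}z)\Big).$$ Here $\log$ of a unipotent element is its nilpotent logarithm. In particular these formulas do define $1$-cocycles, $\sigma_\Phi\circ\Phi$ has semisimple monodromy, and $M_u$ is a unipotent automorphism of $(P,\sigma_\Phi\circ\Phi)$. -/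

import Mathlib

open CategoryTheory
open scoped Manifold ContDiff Matrix RightActions

universe u v w

namespace LogRep


noncomputable section

/-! ### Complex reductive groups -/

/-- A subset of `GL n ℂ` is Zariski closed if it is cut out by polynomials in the matrix entries. -/
def IsZariskiClosed {n : ℕ} (S : Set (GL (Fin n) ℂ)) : Prop :=
  ∃ F : Set (MvPolynomial (Fin n × Fin n) ℂ),
    S = {g : GL (Fin n) ℂ | ∀ f ∈ F,
      MvPolynomial.eval (fun ij => (g : Matrix (Fin n) (Fin n) ℂ) ij.1 ij.2) f = 0}

/-- The structure of a linear algebraic group on a complex Lie group `G`: an isomorphism of complex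
Lie groups from `G` onto a Zariski closed subgroup of some `GL n ℂ`, in other words a faithful
algebraic representation that is a holomorphic embedding. -/
structure LinearAlgebraicGroup (E : Type v) [NormedAddCommGroup E] [NormedSpace ℂ E]
    (G : Type w) [Group G] [TopologicalSpace G] [ChartedSpace E G] where
  /-- the size of the matrices -/
  n : ℕ
  /-- the faithful representation -/
  ρ : G →* GL (Fin n) ℂ
  isEmbedding : Topology.IsEmbedding ρ
  holomorphic : ∀ i j : Fin n,
    ContMDiff 𝓘(ℂ, E) 𝓘(ℂ) ω (fun g : G => (ρ g : Matrix (Fin n) (Fin n) ℂ) i j)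
  immersion : ∀ x : TangentSpace 𝓘(ℂ, E) (1 : G),
    (∀ i j : Fin n,
      mfderiv 𝓘(ℂ, E) 𝓘(ℂ) (fun g : G => (ρ g : Matrix (Fin n) (Fin n) ℂ) i j) 1 x = 0) → x = 0
  zariskiClosed : IsZariskiClosed (Set.range ρ)

/-- The logarithm `log A = ∑ (-1)^k (A - 1)^(k+1) / (k+1)` of a unipotent matrix; the series is
finite, since `(A - 1)^n = 0` for a unipotent matrix `A` of size `n`. -/
def unipotentLog {n : ℕ} (A : Matrix (Fin n) (Fin n) ℂ) : Matrix (Fin n) (Fin n) ℂ :=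
  ∑ k ∈ Finset.range n, ((-1 : ℂ) ^ k / ((k : ℂ) + 1)) • (A - 1) ^ (k + 1)

namespace LinearAlgebraicGroup

variable {E : Type v} [NormedAddCommGroup E] [NormedSpace ℂ E]
  {G : Type w} [Group G] [TopologicalSpace G] [ChartedSpace E G]

/-- The matrix of a group element. -/
def mat (R : LinearAlgebraicGroup E G) (g : G) : Matrix (Fin R.n) (Fin R.n) ℂ :=
  (R.ρ g : Matrix (Fin R.n) (Fin R.n) ℂ)

/-- Semisimple elements: those whose matrix is semisimple (diagonalizable). -/
def IsSemisimple (R : LinearAlgebraicGroup E G) (g : G) : Prop :=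
  Module.End.IsSemisimple (Matrix.toLin' (R.mat g))

/-- Unipotent elements: those whose matrix differs from the identity by a nilpotent matrix. -/
def IsUnipotent (R : LinearAlgebraicGroup E G) (g : G) : Prop :=
  IsNilpotent (R.mat g - 1)

/-- `g = s * u` is the multiplicative Jordan-Chevalley decomposition of `g`. -/
structure IsJordanChevalley (R : LinearAlgebraicGroup E G) (g s u : G) : Prop where
  semisimple : R.IsSemisimple s
  unipotent : R.IsUnipotent u
  mul_eq : s * u = g
  comm : Commute s u

/-- `g = exp (c • log u)`, for a unipotent element `u`. -/
def IsExpLog (R : LinearAlgebraicGroup E G) (c : ℂ) (u g : G) : Prop :=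
  R.IsUnipotent u ∧ R.mat g = NormedSpace.exp (c • unipotentLog (R.mat u))

/-- `G` is reductive: its unipotent radical is trivial, i.e. every connected closed normal subgroup
that consists of unipotent elements is trivial. -/
def IsReductive (R : LinearAlgebraicGroup E G) : Prop :=
  ∀ N : Subgroup G, N.Normal → IsConnected (N : Set G) →
    IsZariskiClosed (R.ρ '' (N : Set G)) → (∀ g ∈ N, R.IsUnipotent g) → N = ⊥

end LinearAlgebraicGroup

/-! ### Holomorphic principal bundles over the affine line -/

/-- A holomorphic principal `G`-bundle over the complex affine line: a complex manifold with a right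
action of `G` and a projection to `ℂ` which is locally isomorphic, as a `G`-space over `ℂ`,
to `V × G → V`. -/
structure PrincipalBundle (E : Type v) [NormedAddCommGroup E] [NormedSpace ℂ E]
    (G : Type w) [Group G] [TopologicalSpace G] [ChartedSpace E G] where
  /-- the total space -/
  carrier : Type u
  [top : TopologicalSpace carrier]
  [charted : ChartedSpace (ModelProd ℂ E) carrier]
  [manifold : IsManifold (𝓘(ℂ).prod 𝓘(ℂ, E)) ω carrier]
  /-- the right action of `G`, written `p <• g` -/
  [action : MulAction (MulOpposite G) carrier]
  /-- the bundle projection -/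
  proj : carrier → ℂ
  proj_smul : ∀ (p : carrier) (g : G), proj (p <• g) = proj p
  /-- around every point of the base there is a biholomorphic equivariant trivialization -/
  locally_trivial : ∀ z : ℂ, ∃ V : Set ℂ, IsOpen V ∧ z ∈ V ∧
    ∃ e : OpenPartialHomeomorph carrier (ℂ × G),
      e.source = proj ⁻¹' V ∧ e.target = V ×ˢ Set.univ ∧
      ContMDiffOn (𝓘(ℂ).prod 𝓘(ℂ, E)) (𝓘(ℂ).prod 𝓘(ℂ, E)) ω e e.source ∧
      ContMDiffOn (𝓘(ℂ).prod 𝓘(ℂ, E)) (𝓘(ℂ).prod 𝓘(ℂ, E)) ω e.symm e.target ∧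
      ∀ p ∈ e.source, (e p).1 = proj p ∧ ∀ g : G, e (p <• g) = ((e p).1, (e p).2 * g)

attribute [instance] PrincipalBundle.top PrincipalBundle.charted PrincipalBundle.manifold
  PrincipalBundle.action

variable {E : Type v} [NormedAddCommGroup E] [NormedSpace ℂ E]
  {G : Type w} [Group G] [TopologicalSpace G] [ChartedSpace E G]

/-- Morphisms of principal bundles: holomorphic equivariant maps over the identity of the base. -/
@[ext]
structure BundleHom (P Q : PrincipalBundle.{u} E G) where
  /-- the underlying map -/
  toFun : P.carrier → Q.carrier
  proj_toFun : ∀ p, Q.proj (toFun p) = P.proj p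
  map_smul : ∀ (p : P.carrier) (g : G), toFun (p <• g) = toFun p <• g
  holomorphic : ContMDiff (𝓘(ℂ).prod 𝓘(ℂ, E)) (𝓘(ℂ).prod 𝓘(ℂ, E)) ω toFun

instance : Category (PrincipalBundle.{u} E G) where
  Hom P Q := BundleHom P Q
  id P := ⟨fun p => p, fun _ => rfl, fun _ _ => rfl, contMDiff_id⟩
  comp f g := ⟨fun p => g.toFun (f.toFun p),
    fun p => (g.proj_toFun _).trans (f.proj_toFun p),
    fun p a => by rw [f.map_smul, g.map_smul],
    g.holomorphic.comp f.holomorphic⟩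

/-! ### Representations of the action groupoid `ℂ ⋉ 𝔸` -/

/-- A representation of the groupoid `ℂ ⋉ 𝔸` on the principal bundle `P`, i.e. a holomorphic groupoid
homomorphism from `ℂ ⋉ 𝔸` to the gauge groupoid of `P`. The arrow `(t, z)`, from `z` to `exp t * z`,
is sent to the equivariant map `P_z → P_{exp t * z}` given by the restriction of `act t` to the
fibre of `P` over `z`. -/
@[ext]
structure Representation (P : PrincipalBundle.{u} E G) where
  /-- `act t p` is the image of `p` under the arrow `(t, P.proj p)` -/
  act : ℂ → P.carrier → P.carrier
  proj_act : ∀ t p, P.proj (act t p) = Complex.exp t * P.proj p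
  act_smul : ∀ (t : ℂ) (p : P.carrier) (g : G), act t (p <• g) = act t p <• g
  act_zero : ∀ p, act 0 p = p
  act_add : ∀ t₁ t₂ p, act (t₁ + t₂) p = act t₁ (act t₂ p)
  holomorphic : ContMDiff (𝓘(ℂ).prod (𝓘(ℂ).prod 𝓘(ℂ, E))) (𝓘(ℂ).prod 𝓘(ℂ, E)) ω
    (fun x : ℂ × P.carrier => act x.1 x.2)

/-- The monodromy of a representation: on the fibre over `z` it is the automorphism
attached to the arrow `(2πi, z)`, from `z` to `z`. -/
def Representation.monodromy {P : PrincipalBundle.{u} E G} (Φ : Representation P) :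
    P.carrier → P.carrier :=
  Φ.act (2 * Real.pi * Complex.I)

/-- A holomorphic groupoid `1`-cocycle of `ℂ ⋉ 𝔸` with values in the representation `Φ`. Its value
`σ(t, z)`, an equivariant automorphism of the fibre over `exp t * z`, is the restriction of
`toFun t` to that fibre. -/
structure Cocycle {P : PrincipalBundle.{u} E G} (Φ : Representation P) where
  /-- `toFun t q` is `σ(t, z) q`, where `q` lies over `exp t * z` -/
  toFun : ℂ → P.carrier → P.carrier
  proj_toFun : ∀ t q, P.proj (toFun t q) = P.proj q
  map_smul : ∀ (t : ℂ) (q : P.carrier) (g : G), toFun t (q <• g) = toFun t q <• g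
  holomorphic : ContMDiff (𝓘(ℂ).prod (𝓘(ℂ).prod 𝓘(ℂ, E))) (𝓘(ℂ).prod 𝓘(ℂ, E)) ω
    (fun x : ℂ × P.carrier => toFun x.1 x.2)
  /-- `σ(μ, exp t * z) ∘ Φ(μ, exp t * z) ∘ σ(t, z) = σ(μ + t, z) ∘ Φ(μ, exp t * z)` -/
  cocycle : ∀ (μ t : ℂ) (q : P.carrier),
    toFun μ (Φ.act μ (toFun t q)) = toFun (μ + t) (Φ.act μ q)

/-- The twist `σ ∘ Φ` of a representation `Φ` by a `1`-cocycle `σ`. -/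
def Cocycle.twist {P : PrincipalBundle.{u} E G} {Φ : Representation P} (σ : Cocycle Φ) :
    Representation P where
  act t p := σ.toFun t (Φ.act t p)
  proj_act t p := (σ.proj_toFun t _).trans (Φ.proj_act t p)
  act_smul t p g := by rw [Φ.act_smul, σ.map_smul]
  act_zero p := by
    have surj : ∃ q, σ.toFun 0 q = p := by
      obtain ⟨V, -, hV, e, hs, ht, -, -, he⟩ := P.locally_trivial (P.proj p)
      have h1 : p ∈ e.source := by rw [hs]; exact hV
      have h2 : σ.toFun 0 p ∈ e.source := by
        rw [hs, Set.mem_preimage, σ.proj_toFun]; exact hV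
      refine ⟨p <• ((e (σ.toFun 0 p)).2⁻¹ * (e p).2), ?_⟩
      rw [σ.map_smul]
      have h3 : σ.toFun 0 p <• ((e (σ.toFun 0 p)).2⁻¹ * (e p).2) ∈ e.source := by
        rw [hs, Set.mem_preimage, P.proj_smul, σ.proj_toFun]; exact hV
      apply e.injOn h3 h1
      rw [(he _ h2).2]
      refine Prod.ext ?_ (by simp)
      change (e (σ.toFun 0 p)).1 = (e p).1
      rw [(he _ h2).1, (he _ h1).1, σ.proj_toFun]
    obtain ⟨q, rfl⟩ := surj
    have h := σ.cocycle 0 0 q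
    simp only [Φ.act_zero, add_zero] at h
    rw [Φ.act_zero]
    exact h
  act_add t₁ t₂ p := by rw [Φ.act_add, σ.cocycle]
  holomorphic := σ.holomorphic.comp (contMDiff_fst.prodMk Φ.holomorphic)

variable (E G) in
/-- Objects of `Rep(ℂ ⋉ 𝔸, G)`: pairs `(P, Φ)`. -/
structure RepObj where
  /-- the principal bundle -/
  bundle : PrincipalBundle.{u} E G
  /-- the representation -/
  rep : Representation bundle

/-- Morphisms of `Rep(ℂ ⋉ 𝔸, G)`: morphisms of principal bundles that intertwine
the representations. -/
@[ext]
structure RepHom (X Y : RepObj.{u} E G) where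
  /-- the underlying morphism of principal bundles -/
  hom : BundleHom X.bundle Y.bundle
  comm : ∀ t p, hom.toFun (X.rep.act t p) = Y.rep.act t (hom.toFun p)

/-- The category `Rep(ℂ ⋉ 𝔸, G)`. -/
instance : Category (RepObj.{u} E G) where
  Hom X Y := RepHom X Y
  id X := ⟨𝟙 X.bundle, fun _ _ => rfl⟩
  comp {X Y Z} f g := ⟨(f.hom ≫ g.hom : X.bundle ⟶ Z.bundle), fun t p => by
    change g.hom.toFun (f.hom.toFun _) = Z.rep.act t (g.hom.toFun (f.hom.toFun p))
    rw [f.comm, g.comm]⟩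

variable (E G) in
/-- The functor that forgets the representation. -/
def repForget : RepObj.{u} E G ⥤ PrincipalBundle.{u} E G where
  obj X := X.bundle
  map f := f.hom

/-! ### The category of Jordan-Chevalley triples -/

/-- A representation has semisimple monodromy if its monodromy at every non-zero point `z` is
a semisimple element of `Aut(P_z)`, the latter being identified with `G` by a point of `P_z`. -/
def HasSemisimpleMonodromy (R : LinearAlgebraicGroup E G) {P : PrincipalBundle.{u} E G}
    (Φ : Representation P) : Prop :=
  ∀ p : P.carrier, P.proj p ≠ 0 → ∃ g : G, Φ.monodromy p = p <• g ∧ R.IsSemisimple g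

/-- A bundle endomorphism is unipotent if it is unipotent on every fibre. -/
def IsUnipotentMap (R : LinearAlgebraicGroup E G) {P : PrincipalBundle.{u} E G}
    (U : P.carrier → P.carrier) : Prop :=
  ∀ p : P.carrier, ∃ u : G, U p = p <• u ∧ R.IsUnipotent u

/-- On every fibre, `U` is the unipotent component of `M`. -/
def IsUnipotentPart (R : LinearAlgebraicGroup E G) {P : PrincipalBundle.{u} E G}
    (M U : P.carrier → P.carrier) : Prop :=
  ∀ p : P.carrier, ∃ g s u : G,
    M p = p <• g ∧ R.IsJordanChevalley g s u ∧ U p = p <• u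

/-- On every fibre, `T = exp (c log U)`. -/
def IsExpLogMap (R : LinearAlgebraicGroup E G) {P : PrincipalBundle.{u} E G} (c : ℂ)
    (U T : P.carrier → P.carrier) : Prop :=
  ∀ p : P.carrier, ∃ u g : G, U p = p <• u ∧ R.IsExpLog c u g ∧ T p = p <• g

/-- Objects of the category `JC`: triples `(P, Ψ, U)` of a principal bundle, a representation
with semisimple monodromy, and a unipotent automorphism of `(P, Ψ)`. -/
structure JCObj (R : LinearAlgebraicGroup E G) where
  /-- the pair `(P, Ψ)` -/
  base : RepObj.{u} E G
  semisimple : HasSemisimpleMonodromy R base.rep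
  /-- the automorphism `U` -/
  aut : base ≅ base
  unipotent : IsUnipotentMap R aut.hom.hom.toFun

/-- Morphisms of `JC`: morphisms of representations that commute with the automorphisms. -/
@[ext]
structure JCHom {R : LinearAlgebraicGroup E G} (X Y : JCObj.{u} R) where
  /-- the underlying morphism of representations -/
  hom : X.base ⟶ Y.base
  comm : X.aut.hom ≫ hom = hom ≫ Y.aut.hom

/-- The category `JC`. -/
instance (R : LinearAlgebraicGroup E G) : Category (JCObj.{u} R) where
  Hom X Y := JCHom X Y
  id X := ⟨𝟙 X.base, by rw [Category.comp_id, Category.id_comp]⟩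
  comp f g := ⟨f.hom ≫ g.hom, by
    rw [← Category.assoc, f.comm, Category.assoc, g.comm, Category.assoc]⟩

/-- The functor that forgets the representation and the automorphism. -/
def jcForget (R : LinearAlgebraicGroup E G) : JCObj.{u} R ⥤ PrincipalBundle.{u} E G where
  obj X := X.base.bundle
  map f := f.hom.hom

end

end LogRep

/-!
# Splitting off the unipotent part of the monodromy

A point `p` of a principal bundle identifies the automorphism group of its fibre with `G`. Hence the
monodromy of a representation is an equivariant function `p ↦ h(p)` on the total space with values
in `G`, the holonomy, and it is invariant under the groupoid. Everything below takes place on the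
level of such functions (`UnipotentField`).

The decisive point is that the unipotent part of `h` is again holomorphic, also over `0`. The
groupoid is transitive on the complement of `0`, so that there `h` runs through one conjugacy class.
The semisimple part of one matrix in this class is a polynomial `r` in this matrix, and the
identities which say that `r(A)` is semisimple and `A - r(A)` nilpotent are invariant under
conjugation and pass to the closure (`exists_mat_semisimplePart_eq_aeval`). So `r(h)` is the
semisimple part of `h` everywhere. A map into `G` is holomorphic as soon as its matrix entries are,
since the given matrix representation is an embedding and an immersion
(`contMDiff_of_contMDiff_mat`).

That the Jordan-Chevalley components and the elements `exp (c log u)` lie in `G` follows from the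
equations that define `G`: evaluated at `s ^ k * exp (t log u)` they are exponential polynomials in
`k` and `t`, and they vanish for all `k = t`, where they are evaluated at the powers of `s * u`.
An exponential polynomial that vanishes for all natural numbers `k = t` is zero, because the
generalized eigenspaces of the shift operator on sequences are independent
(`expPoly_eq_zero_of_diagonal`, `exists_mat_eq_pow_mul_exp`).

Twisting a representation by `exp (t c log U)`, for a unipotent automorphism `U`, multiplies the
holonomy by `exp (2πi c log U)`. For `2πi c = -1` and `U = M_u` this leaves the semisimple part; for
`2πi c = 1` and a representation with semisimple monodromy, the result has `U` as the unipotent part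
of its monodromy, by uniqueness of the Jordan-Chevalley decomposition over the complement of `0` and
by continuity over `0` (`val_ofMonodromy_twist`). Since `exp (t c log U)` and `exp (-t c log U)`
cancel, the two constructions are inverse to each other. They are compatible with morphisms since a
morphism preserves the holonomy.
-/

namespace LogRep

/-! ### Exponentials and logarithms of nilpotent elements -/

section NilpotentExp

variable {𝔸 : Type*} [NormedRing 𝔸] [NormedAlgebra ℂ 𝔸]

theorem exp_smul_eq_sum_of_pow_eq_zero {L : 𝔸} {n : ℕ} (hL : L ^ n = 0) (c : ℂ) :
    NormedSpace.exp (c • L) =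
      ∑ k ∈ Finset.range n, (c ^ k * ((k.factorial : ℂ)⁻¹)) • L ^ k := by
  rw [NormedSpace.exp_eq_tsum ℂ]
  simp only
  rw [tsum_eq_sum (s := Finset.range n)]
  · refine Finset.sum_congr rfl fun k _ => ?_
    rw [smul_pow, smul_smul, mul_comm]
  · intro k hk
    rw [Finset.mem_range, not_lt] at hk
    rw [smul_pow, pow_eq_zero_of_le hk hL, smul_zero, smul_zero]

variable [CompleteSpace 𝔸]

theorem hasDerivAt_exp_of_commute {f : ℂ → 𝔸} {f' : 𝔸} {t : ℂ} (hf : HasDerivAt f f' t)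
    (hc : ∀ s, Commute (f t) (f s)) :
    HasDerivAt (fun s => NormedSpace.exp (f s)) (NormedSpace.exp (f t) * f') t := by
  have hsplit : (fun s => NormedSpace.exp (f s)) =
      fun s => NormedSpace.exp (f t) * NormedSpace.exp (f s - f t) := by
    funext s
    let _ : NormedAlgebra ℚ 𝔸 := NormedAlgebra.restrictScalars ℚ ℂ 𝔸
    rw [← NormedSpace.exp_add_of_commute ((hc s).sub_right (Commute.refl _)), add_sub_cancel]
  rw [hsplit]
  have h0 : HasFDerivAt (NormedSpace.exp : 𝔸 → 𝔸) (1 : 𝔸 →L[ℂ] 𝔸) (f t - f t) := by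
    rw [sub_self]
    exact hasFDerivAt_exp_zero
  simpa using (h0.comp_hasDerivAt t (hf.sub_const (f t))).const_mul (NormedSpace.exp (f t))

/-- The derivative of `t ↦ exp (-log (1 + t N)) * (1 + t N)` vanishes, so that the value at
`t = 1` is the value `1` at `t = 0`. -/
theorem exp_log_one_add_of_pow_eq_zero {N : 𝔸} {n : ℕ} (hN : N ^ n = 0) :
    NormedSpace.exp (∑ k ∈ Finset.range n, ((-1 : ℂ) ^ k / ((k : ℂ) + 1)) • N ^ (k + 1)) =
      1 + N := by
  let _ : NormedAlgebra ℚ 𝔸 := NormedAlgebra.restrictScalars ℚ ℂ 𝔸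
  set L : ℂ → 𝔸 := fun t =>
    ∑ k ∈ Finset.range n, (t ^ (k + 1) * ((-1 : ℂ) ^ k / ((k : ℂ) + 1))) • N ^ (k + 1) with hL
  set L' : ℂ → 𝔸 := fun t => ∑ k ∈ Finset.range n, (-(t • N)) ^ k * N with hL'
  have hderiv : ∀ t, HasDerivAt L (L' t) t := by
    intro t
    refine HasDerivAt.fun_sum fun k _ => ?_
    have h := (((hasDerivAt_pow (k + 1) t).mul_const ((-1 : ℂ) ^ k / ((k : ℂ) + 1))).smul_const
      (N ^ (k + 1)))
    convert h using 1
    have hk : (k : ℂ) + 1 ≠ 0 := Nat.cast_add_one_ne_zero k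
    rw [show -(t • N) = (-t) • N by simp, smul_pow, smul_mul_assoc, ← pow_succ, neg_pow]
    congr 1
    push_cast
    field_simp
  -- the geometric series `L' t = N (1 + t N)⁻¹`, which is finite
  have hgeom : ∀ t, L' t * (1 + t • N) = N := by
    intro t
    have hcN : Commute N (1 + t • N) :=
      (Commute.one_right N).add_right ((Commute.refl N).smul_right t)
    have h := geom_sum_mul_neg (-(t • N)) n
    rw [show -(t • N) = (-t) • N by simp, smul_pow, hN, smul_zero, sub_zero, neg_smul,
      sub_neg_eq_add] at h
    rw [hL']
    simp only
    rw [← Finset.sum_mul, mul_assoc, hcN.eq, ← mul_assoc, h, one_mul]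
  have hcomm : ∀ s t, Commute (L s) (L t) := fun s t =>
    Commute.sum_left _ _ _ fun i _ => Commute.sum_right _ _ _ fun j _ =>
      (((Commute.refl N).pow_pow _ _).smul_right _).smul_left _
  have hF : ∀ t, HasDerivAt (fun t => NormedSpace.exp (-L t) * (1 + t • N)) 0 t := by
    intro t
    have h1 : HasDerivAt (fun t : ℂ => 1 + t • N) N t := by
      simpa using ((hasDerivAt_id t).smul_const N).const_add (1 : 𝔸)
    have h2 := hasDerivAt_exp_of_commute (hderiv t).fun_neg
      (fun s => ((hcomm t s).neg_left).neg_right)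
    convert h2.fun_mul h1 using 1
    rw [mul_neg, neg_mul, mul_assoc, hgeom]
    simp
  have hconst := is_const_of_deriv_eq_zero (fun t => (hF t).differentiableAt)
    (fun t => (hF t).deriv) 1 0
  have h0 : L 0 = 0 := by simp [hL]
  have h1 : L 1 =
      ∑ k ∈ Finset.range n, ((-1 : ℂ) ^ k / ((k : ℂ) + 1)) • N ^ (k + 1) := by simp [hL]
  rw [h0, h1] at hconst
  simp only [neg_zero, NormedSpace.exp_zero, zero_smul, add_zero, mul_one, one_smul] at hconst
  have hc := congrArg (fun x =>
    NormedSpace.exp (∑ k ∈ Finset.range n, ((-1 : ℂ) ^ k / ((k : ℂ) + 1)) • N ^ (k + 1)) * x)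
    hconst
  simp only [mul_one] at hc
  rw [← mul_assoc, ← NormedSpace.exp_add_of_commute (Commute.neg_right (Commute.refl _)),
    add_neg_cancel, NormedSpace.exp_zero, one_mul] at hc
  exact hc.symm

end NilpotentExp

/-! ### Unipotent logarithms of matrices -/

section UnipotentLog

variable {n : ℕ}

theorem matrix_pow_eq_zero_of_isNilpotent {N : Matrix (Fin n) (Fin n) ℂ} (hN : IsNilpotent N) :
    N ^ n = 0 := by
  have h := (Matrix.isNilpotent_charpoly_sub_pow_of_isNilpotent hN).eq_zero
  have h2 := Matrix.aeval_self_charpoly N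
  rw [sub_eq_zero.mp h] at h2
  simpa using h2

theorem unipotentLog_pow_eq_zero {A : Matrix (Fin n) (Fin n) ℂ} (hA : IsNilpotent (A - 1)) :
    unipotentLog A ^ n = 0 := by
  apply matrix_pow_eq_zero_of_isNilpotent
  have : unipotentLog A =
      (A - 1) * ∑ k ∈ Finset.range n, ((-1 : ℂ) ^ k / ((k : ℂ) + 1)) • (A - 1) ^ k := by
    simp [unipotentLog, Finset.mul_sum, pow_succ']
  rw [this]
  refine Commute.isNilpotent_mul_right (Commute.sum_right _ _ _ fun k _ => ?_) hA
  exact ((Commute.refl _).pow_right k).smul_right _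

open scoped Matrix.Norms.Operator in
theorem exp_unipotentLog {A : Matrix (Fin n) (Fin n) ℂ} (hA : IsNilpotent (A - 1)) :
    NormedSpace.exp (unipotentLog A) = A :=
  (exp_log_one_add_of_pow_eq_zero (matrix_pow_eq_zero_of_isNilpotent hA)).trans
    (add_sub_cancel 1 A)

open scoped Matrix.Norms.Operator in
theorem exp_smul_unipotentLog {A : Matrix (Fin n) (Fin n) ℂ} (hA : IsNilpotent (A - 1)) (c : ℂ) :
    NormedSpace.exp (c • unipotentLog A) =
      ∑ k ∈ Finset.range n, (c ^ k * ((k.factorial : ℂ)⁻¹)) • unipotentLog A ^ k :=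
  exp_smul_eq_sum_of_pow_eq_zero (unipotentLog_pow_eq_zero hA) c

theorem exp_add_smul (a b : ℂ) (L : Matrix (Fin n) (Fin n) ℂ) :
    NormedSpace.exp ((a + b) • L) = NormedSpace.exp (a • L) * NormedSpace.exp (b • L) := by
  rw [add_smul]
  exact Matrix.exp_add_of_commute _ _ (((Commute.refl L).smul_left a).smul_right b)

theorem semiconjBy_unipotentLog {P A B : Matrix (Fin n) (Fin n) ℂ} (h : SemiconjBy P A B) :
    SemiconjBy P (unipotentLog A) (unipotentLog B) := by
  rw [SemiconjBy, unipotentLog, unipotentLog, Finset.mul_sum, Finset.sum_mul]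
  refine Finset.sum_congr rfl fun k _ => ?_
  rw [mul_smul_comm, smul_mul_assoc,
    ((h.sub_right (SemiconjBy.one_right P)).pow_right (k + 1)).eq]

end UnipotentLog

/-! ### Jordan-Chevalley decomposition of matrices -/

section MatrixJordanChevalley

open Polynomial

variable {n : ℕ}

theorem isNilpotent_toLin' {A : Matrix (Fin n) (Fin n) ℂ} (hA : IsNilpotent A) :
    IsNilpotent (Matrix.toLin' A) := hA.map (Matrix.toLinAlgEquiv' (R := ℂ) (n := Fin n))

theorem matrix_semisimplePart_unique {A s s' : Matrix (Fin n) (Fin n) ℂ}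
    (hs : Module.End.IsSemisimple (Matrix.toLin' s))
    (hs' : Module.End.IsSemisimple (Matrix.toLin' s'))
    (hn : IsNilpotent (A - s)) (hn' : IsNilpotent (A - s')) (hc : Commute A s)
    (hc' : Commute A s') : s = s' := by
  have hcomm : ∀ x : Matrix (Fin n) (Fin n) ℂ, Commute A x →
      Commute (Matrix.toLin' (A - x)) (Matrix.toLin' x) := fun x hx =>
    (hx.sub_left (Commute.refl x)).map (Matrix.toLinAlgEquiv' (R := ℂ) (n := Fin n))
  have h := Module.End.isNilpotent_isSemisimple_unique (isNilpotent_toLin' hn) hs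
    (isNilpotent_toLin' hn') hs' (hcomm s hc) (hcomm s' hc')
    (by rw [← map_add, ← map_add, sub_add_cancel, sub_add_cancel])
  exact Matrix.toLin'.injective h.2

/-- The semisimple part of a matrix `A` is a polynomial `r` in `A`. That `r(A)` is semisimple and
`A - r(A)` nilpotent is expressed by polynomial identities, which pass to the limit. -/
theorem exists_polynomial_semisimplePart (A : Matrix (Fin n) (Fin n) ℂ) :
    ∃ (r q : ℂ[X]) (k : ℕ), Squarefree q ∧ aeval (aeval A r) q = 0 ∧ (A - aeval A r) ^ k = 0 := by
  obtain ⟨m, -, s, hs, ⟨k, hk⟩, hss, h⟩ :=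
    Module.End.exists_isNilpotent_isSemisimple (f := Matrix.toLin' A)
  rw [Algebra.adjoin_singleton_eq_range_aeval] at hs
  obtain ⟨r, rfl⟩ := hs
  have hA : ∀ (B : Matrix (Fin n) (Fin n) ℂ) (p : ℂ[X]),
      aeval (Matrix.toLin' B) p = Matrix.toLin' (aeval B p) := fun B p =>
    aeval_algHom_apply (Matrix.toLinAlgEquiv' (R := ℂ) (n := Fin n)) B p
  refine ⟨r, minpoly ℂ (aeval (Matrix.toLin' A) r), k, hss.minpoly_squarefree, ?_, ?_⟩
  · apply Matrix.toLin'.injective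
    rw [← hA, ← hA, map_zero]
    exact minpoly.aeval ℂ (aeval (Matrix.toLin' A) r)
  · apply Matrix.toLin'.injective
    rw [map_zero, ← hk, eq_sub_of_add_eq h.symm]
    change Matrix.toLinAlgEquiv' _ = (Matrix.toLinAlgEquiv' A - aeval (Matrix.toLin' A) r) ^ k
    rw [map_pow, map_sub]
    congr 2
    exact (hA A r).symm

theorem isSemisimple_toLin'_of_squarefree {s : Matrix (Fin n) (Fin n) ℂ} {q : ℂ[X]}
    (hq : Squarefree q) (h : aeval s q = 0) : Module.End.IsSemisimple (Matrix.toLin' s) := by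
  refine Module.End.isSemisimple_of_squarefree_aeval_eq_zero hq ?_
  have := aeval_algHom_apply (Matrix.toLinAlgEquiv' (R := ℂ) (n := Fin n)) s q
  rw [h, map_zero] at this
  exact this

end MatrixJordanChevalley

/-! ### Exponential polynomials -/

section ExpPoly

open Polynomial

/-- The value `∑ μ ^ k * P_μ(t)` of the formal exponential polynomial `∑ P_μ · [μ]`, where the
exponent `k` and the argument `t` of the coefficients are kept independent of each other. -/
noncomputable def expPolyEval (k : ℕ) (t : ℂ) : MonoidAlgebra ℂ[X] ℂˣ →ₐ[ℂ] ℂ :=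
  MonoidAlgebra.liftNCAlgHom (Polynomial.aeval t)
    ((powMonoidHom k : ℂ →* ℂ).comp (Units.coeHom ℂ)) fun _ _ => Commute.all _ _

theorem expPolyEval_single (k : ℕ) (t : ℂ) (μ : ℂˣ) (P : ℂ[X]) :
    expPolyEval k t (MonoidAlgebra.single μ P) = P.eval t * (μ : ℂ) ^ k := by
  simp [expPolyEval, MonoidAlgebra.liftNCAlgHom]

theorem expPolyEval_apply (k : ℕ) (t : ℂ) (F : MonoidAlgebra ℂ[X] ℂˣ) :
    expPolyEval k t F = ∑ μ ∈ F.coeff.support, (F.coeff μ).eval t * (μ : ℂ) ^ k := by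
  conv_lhs => rw [← MonoidAlgebra.sum_coeff_single F]
  rw [map_finsuppSum]
  exact Finset.sum_congr rfl fun μ _ => expPolyEval_single k t μ _

/-- The shift operator on complex sequences. -/
def shift : Module.End ℂ (ℕ → ℂ) where
  toFun a k := a (k + 1)
  map_add' _ _ := rfl
  map_smul' _ _ := rfl

theorem mul_pow_mem_maxGenEigenspace_shift (P : ℂ[X]) (μ : ℂ) :
    (fun k : ℕ => P.eval (k : ℂ) * μ ^ k) ∈ shift.maxGenEigenspace μ := by
  -- on `f(k) μ ^ k`, the operator `shift - μ` acts as `μ` times the forward difference of `f`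
  have key : ∀ (d : ℕ) (f : ℂ → ℂ), ((shift - algebraMap ℂ _ μ) ^ d)
      (fun k : ℕ => f k * μ ^ k) = fun k : ℕ => (fwdDiff 1)^[d] f k * μ ^ (k + d) := by
    intro d
    induction d with
    | zero => intro f; simp
    | succ d ih =>
      intro f
      have h1 : (shift - algebraMap ℂ (Module.End ℂ (ℕ → ℂ)) μ) (fun k : ℕ => f k * μ ^ k) =
          μ • fun k : ℕ => fwdDiff 1 f k * μ ^ k := by
        funext k
        simp only [shift, LinearMap.sub_apply, Module.algebraMap_end_apply, LinearMap.coe_mk,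
          AddHom.coe_mk, Pi.sub_apply, Pi.smul_apply, smul_eq_mul, fwdDiff]
        push_cast
        ring
      rw [pow_succ, Module.End.mul_apply, h1, map_smul, ih]
      funext k
      simp only [Pi.smul_apply, smul_eq_mul, Function.iterate_succ_apply]
      ring
  rw [Module.End.mem_maxGenEigenspace]
  refine ⟨P.natDegree + 1, ?_⟩
  have h := key (P.natDegree + 1) (fun x => P.eval x)
  rw [Algebra.algebraMap_eq_smul_one] at h
  rw [h]
  funext k
  rw [Polynomial.fwdDiff_iter_degree_add_one_eq_zero]
  simp

/-- Generalized eigenspaces of the shift operator are independent, so that an exponential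
polynomial is determined by its values at `t = k` for natural numbers `k`. -/
theorem expPoly_eq_zero_of_diagonal {F : MonoidAlgebra ℂ[X] ℂˣ}
    (h : ∀ k : ℕ, expPolyEval k (k : ℂ) F = 0) : F = 0 := by
  have hind := (iSupIndep_iff_finsetSum_eq_zero_imp_eq_zero _).mp
    ((shift.independent_maxGenEigenspace).comp Units.val_injective) F.coeff.support
    (fun μ k => (F.coeff μ).eval (k : ℂ) * (μ : ℂ) ^ k)
    (fun μ _ => mul_pow_mem_maxGenEigenspace_shift (F.coeff μ) μ)
    (by
      funext k
      rw [Finset.sum_apply, ← expPolyEval_apply, h, Pi.zero_apply])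
  have hz : ∀ μ, F.coeff μ = 0 := by
    intro μ
    by_contra hμ
    have h0 := hind μ (by simpa using hμ)
    refine hμ (Polynomial.eq_zero_of_infinite_isRoot _ ?_)
    refine (Set.infinite_range_of_injective (Nat.cast_injective (R := ℂ))).mono ?_
    rintro _ ⟨k, rfl⟩
    have := congrFun h0 k
    simpa using this
  exact MonoidAlgebra.coeff_injective (Finsupp.ext hz)

/-- For a semisimple invertible matrix `s`, the entries of `s ^ k` are exponential polynomials
in `k`, with constant coefficients. -/
theorem exists_expPoly_pow_mulVec {n : ℕ} {s : Matrix (Fin n) (Fin n) ℂ}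
    (hs : Module.End.IsSemisimple (Matrix.toLin' s)) (hu : IsUnit s) (v : Fin n → ℂ) :
    ∃ w : Fin n → MonoidAlgebra ℂ[X] ℂˣ,
      ∀ (k : ℕ) (t : ℂ) (i : Fin n), expPolyEval k t (w i) = ((s ^ k) *ᵥ v) i := by
  have hv : v ∈ ⨆ μ, Module.End.eigenspace (Matrix.toLin' s) μ := by
    rw [hs.iSup_eigenspace_eq_top]
    trivial
  induction hv using Submodule.iSup_induction' with
  | mem μ v hv =>
    rw [Module.End.mem_eigenspace_iff, Matrix.toLin'_apply] at hv
    rcases eq_or_ne μ 0 with rfl | hμ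
    · have : v = 0 := by
        obtain ⟨a, rfl⟩ := hu
        have := congrArg (fun x => (↑a⁻¹ : Matrix (Fin n) (Fin n) ℂ) *ᵥ x) hv
        simpa [Matrix.mulVec_mulVec] using this
      subst this
      exact ⟨0, by simp⟩
    · refine ⟨fun i => MonoidAlgebra.single (Units.mk0 μ hμ) (C (v i)), fun k t i => ?_⟩
      have hk : (s ^ k) *ᵥ v = μ ^ k • v := by
        induction k with
        | zero => simp
        | succ k ih => rw [pow_succ, ← Matrix.mulVec_mulVec, hv, Matrix.mulVec_smul, ih, smul_smul,
            pow_succ']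
      rw [expPolyEval_single, hk]
      simp [mul_comm]
  | zero => exact ⟨0, by simp⟩
  | add x y _ _ hx hy =>
    obtain ⟨a, ha⟩ := hx
    obtain ⟨b, hb⟩ := hy
    exact ⟨a + b, fun k t i => by simp [ha, hb, Matrix.mulVec_add]⟩

/-- The polynomial identities satisfied by `s ^ k * exp (k L)` for all natural numbers `k` are
satisfied by `s ^ k * exp (t L)` for all `k` and `t`. -/
theorem eval_pow_mul_exp_eq_zero {n : ℕ} {s L : Matrix (Fin n) (Fin n) ℂ}
    (hs : Module.End.IsSemisimple (Matrix.toLin' s)) (hu : IsUnit s)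
    (hL : ∀ c : ℂ, NormedSpace.exp (c • L) =
      ∑ k ∈ Finset.range n, (c ^ k * ((k.factorial : ℂ)⁻¹)) • L ^ k)
    {f : MvPolynomial (Fin n × Fin n) ℂ}
    (hf : ∀ k : ℕ, MvPolynomial.eval
      (fun ij => (s ^ k * NormedSpace.exp ((k : ℂ) • L)) ij.1 ij.2) f = 0)
    (k : ℕ) (t : ℂ) :
    MvPolynomial.eval (fun ij => (s ^ k * NormedSpace.exp (t • L)) ij.1 ij.2) f = 0 := by
  choose S hS using fun j => exists_expPoly_pow_mulVec hs hu (Pi.single j 1)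
  -- `S` and `T` are the entries of `s ^ k` and of `exp (t L)`, and `Y` those of the product
  let T : Fin n → Fin n → ℂ[X] := fun i j =>
    ∑ m ∈ Finset.range n, C ((m.factorial : ℂ)⁻¹ * (L ^ m) i j) * X ^ m
  let Y : Fin n × Fin n → MonoidAlgebra ℂ[X] ℂˣ := fun ij =>
    ∑ l, S l ij.1 * MonoidAlgebra.single 1 (T l ij.2)
  have hY : ∀ (k : ℕ) (t : ℂ) (ij : Fin n × Fin n),
      expPolyEval k t (Y ij) = (s ^ k * NormedSpace.exp (t • L)) ij.1 ij.2 := by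
    intro k t ij
    simp only [Y, map_sum, map_mul, hS, expPolyEval_single, Matrix.mul_apply]
    refine Finset.sum_congr rfl fun l _ => ?_
    congr 1
    · simp
    · rw [hL]
      simp only [T, Units.val_one, one_pow, mul_one, Polynomial.eval_finsetSum, Matrix.sum_apply,
        Matrix.smul_apply, smul_eq_mul, eval_mul, eval_C, eval_pow, eval_X]
      exact Finset.sum_congr rfl fun m _ => by ring
  have hev : ∀ (k : ℕ) (t : ℂ), expPolyEval k t (MvPolynomial.aeval Y f) =
      MvPolynomial.eval (fun ij => (s ^ k * NormedSpace.exp (t • L)) ij.1 ij.2) f := by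
    intro k t
    rw [← funext (hY k t), ← MvPolynomial.coe_aeval_eq_eval]
    exact MvPolynomial.comp_aeval_apply Y (expPolyEval k t) f
  rw [← hev, expPoly_eq_zero_of_diagonal (fun k => (hev k k).trans (hf k)), map_zero]

end ExpPoly

/-! ### Jordan-Chevalley decomposition in linear algebraic groups -/

namespace LinearAlgebraicGroup

variable {E : Type v} [NormedAddCommGroup E] [NormedSpace ℂ E]
  {G : Type w} [Group G] [TopologicalSpace G] [ChartedSpace E G] (R : LinearAlgebraicGroup E G)

theorem mat_mul (g h : G) : R.mat (g * h) = R.mat g * R.mat h := by simp [mat]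

theorem mat_one : R.mat 1 = 1 := by simp [mat]

theorem mat_pow (g : G) (k : ℕ) : R.mat (g ^ k) = R.mat g ^ k := by simp [mat]

theorem isUnit_mat (g : G) : IsUnit (R.mat g) := (R.ρ g).isUnit

theorem mat_injective : Function.Injective R.mat :=
  Units.val_injective.comp R.isEmbedding.injective

variable {R} in
theorem commute_iff_mat {g h : G} : Commute g h ↔ Commute (R.mat g) (R.mat h) := by
  rw [commute_iff_eq, commute_iff_eq, ← mat_mul, ← mat_mul, R.mat_injective.eq_iff]

theorem exists_mat_eq_of_forall_eval_eq_zero {A : Matrix (Fin R.n) (Fin R.n) ℂ} (hA : IsUnit A)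
    (h : ∀ f : MvPolynomial (Fin R.n × Fin R.n) ℂ,
      (∀ g : G, MvPolynomial.eval (fun ij => R.mat g ij.1 ij.2) f = 0) →
        MvPolynomial.eval (fun ij => A ij.1 ij.2) f = 0) :
    ∃ g : G, R.mat g = A := by
  obtain ⟨F, hF⟩ := R.zariskiClosed
  obtain ⟨a, rfl⟩ := hA
  have ha : a ∈ Set.range R.ρ := by
    rw [hF]
    intro f hf
    refine h f fun g => ?_
    have hg : R.ρ g ∈ Set.range R.ρ := ⟨g, rfl⟩
    rw [hF] at hg
    exact hg f hf
  obtain ⟨g, rfl⟩ := ha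
  exact ⟨g, rfl⟩

/-- If `s * u` lies in the algebraic group, for commuting matrices `s` semisimple and `u`
unipotent, then so do all `s ^ k * exp (t log u)`: the equations of the group hold at the powers
`s ^ k * exp (k log u)` of `s * u`. -/
theorem exists_mat_eq_pow_mul_exp {s U : Matrix (Fin R.n) (Fin R.n) ℂ} {g : G}
    (hs : Module.End.IsSemisimple (Matrix.toLin' s)) (hsu : IsUnit s) (hU : IsNilpotent (U - 1))
    (hc : Commute s U) (hg : R.mat g = s * U) (k : ℕ) (t : ℂ) :
    ∃ h : G, R.mat h = s ^ k * NormedSpace.exp (t • unipotentLog U) := by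
  refine R.exists_mat_eq_of_forall_eval_eq_zero
    ((hsu.pow k).mul (Matrix.isUnit_exp (t • unipotentLog U))) fun f hf => ?_
  refine eval_pow_mul_exp_eq_zero hs hsu (exp_smul_unipotentLog hU) (fun k => ?_) k t
  have h := hf (g ^ k)
  rw [mat_pow, hg, hc.mul_pow] at h
  rw [Nat.cast_smul_eq_nsmul, Matrix.exp_nsmul, exp_unipotentLog hU]
  exact h

theorem exists_isJordanChevalley (g : G) : ∃ s u : G, R.IsJordanChevalley g s u := by
  obtain ⟨r, q, k, hq, hrq, hk⟩ := exists_polynomial_semisimplePart (R.mat g)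
  set A := R.mat g with hA
  set S := Polynomial.aeval A r with hS
  have hss := isSemisimple_toLin'_of_squarefree hq hrq
  have hAS : Commute A S := by
    have := (Polynomial.commute_X r).map (Polynomial.aeval (R := ℂ) A)
    rwa [Polynomial.aeval_X] at this
  have hnil : IsNilpotent (A - S) := ⟨k, hk⟩
  have hSu : IsUnit S := by
    have h := hnil.neg.isUnit_add_left_of_commute (R.isUnit_mat g)
      (((Commute.refl A).sub_left hAS.symm).neg_left)
    rwa [neg_sub, add_sub_cancel] at h
  obtain ⟨a, ha⟩ := hSu
  set b : Matrix (Fin R.n) (Fin R.n) ℂ := ↑a⁻¹ with hb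
  have hcomm : Commute b A := by
    rw [← ha] at hAS
    exact hAS.symm.units_inv_left
  have hmul : S * (b * A) = A := by rw [← ha, hb, Units.mul_inv_cancel_left]
  have hU : IsNilpotent (b * A - 1) := by
    have h1 : b * A - 1 = b * (A - S) := by rw [mul_sub, ← ha, hb, Units.inv_mul]
    rw [h1]
    refine Commute.isNilpotent_mul_left (hcomm.sub_right ?_) hnil
    rw [← ha]
    exact (Commute.refl (a : Matrix (Fin R.n) (Fin R.n) ℂ)).units_inv_left
  have hSU : Commute S (b * A) := by
    refine Commute.mul_right ?_ hAS.symm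
    rw [← ha]
    exact (Commute.refl (a : Matrix (Fin R.n) (Fin R.n) ℂ)).units_inv_right
  -- `s ^ k * exp (t log u)` is `s` for `(k, t) = (1, 0)` and `u` for `(k, t) = (0, 1)`
  obtain ⟨s, hs⟩ := R.exists_mat_eq_pow_mul_exp hss ⟨a, ha⟩ hU hSU (hA.symm.trans hmul.symm) 1 0
  obtain ⟨u, hu⟩ := R.exists_mat_eq_pow_mul_exp hss ⟨a, ha⟩ hU hSU (hA.symm.trans hmul.symm) 0 1
  rw [pow_one, zero_smul, NormedSpace.exp_zero, mul_one] at hs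
  rw [pow_zero, one_smul, exp_unipotentLog hU, one_mul] at hu
  refine ⟨s, u, ?_, ?_, R.mat_injective ?_, (commute_iff_mat (R := R)).mpr ?_⟩
  · rw [IsSemisimple, hs]
    exact hss
  · rw [IsUnipotent, hu]
    exact hU
  · rw [mat_mul, hs, hu, hmul]
  · rwa [hs, hu]

variable {R} in
theorem IsJordanChevalley.isNilpotent_mat_sub {g s u : G} (h : R.IsJordanChevalley g s u) :
    IsNilpotent (R.mat g - R.mat s) := by
  have h1 : R.mat g - R.mat s = R.mat s * (R.mat u - 1) := by
    rw [← h.mul_eq, mat_mul, mul_sub, mul_one]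
  rw [h1]
  exact Commute.isNilpotent_mul_left
    ((commute_iff_mat.mp h.comm).sub_right (Commute.one_right _)) h.unipotent

variable {R} in
theorem IsJordanChevalley.mat_semisimple_eq {g s u : G} (h : R.IsJordanChevalley g s u)
    {S : Matrix (Fin R.n) (Fin R.n) ℂ} (hS : Module.End.IsSemisimple (Matrix.toLin' S))
    (hn : IsNilpotent (R.mat g - S)) (hc : Commute (R.mat g) S) : R.mat s = S := by
  refine matrix_semisimplePart_unique h.semisimple hS h.isNilpotent_mat_sub hn ?_ hc
  rw [← commute_iff_mat, ← h.mul_eq]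
  exact (Commute.refl s).mul_left h.comm.symm

variable {R} in
theorem IsJordanChevalley.unique {g s u s' u' : G} (h : R.IsJordanChevalley g s u)
    (h' : R.IsJordanChevalley g s' u') : s = s' ∧ u = u' := by
  have hs : s = s' := by
    refine R.mat_injective (h.mat_semisimple_eq h'.semisimple h'.isNilpotent_mat_sub ?_)
    rw [← commute_iff_mat, ← h'.mul_eq]
    exact (Commute.refl s').mul_left h'.comm.symm
  refine ⟨hs, ?_⟩
  have := h.mul_eq.trans h'.mul_eq.symm
  rwa [hs, mul_right_inj] at this

/-- The semisimple part of a group element. -/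
noncomputable def semisimplePart (g : G) : G := (R.exists_isJordanChevalley g).choose

/-- The unipotent part of a group element. -/
noncomputable def unipotentPart (g : G) : G := (R.exists_isJordanChevalley g).choose_spec.choose

theorem isJordanChevalley (g : G) :
    R.IsJordanChevalley g (R.semisimplePart g) (R.unipotentPart g) :=
  (R.exists_isJordanChevalley g).choose_spec.choose_spec

variable {R} in
theorem IsSemisimple.conj {s : G} (hs : R.IsSemisimple s) (g : G) :
    R.IsSemisimple (g⁻¹ * s * g) := by
  let c := Matrix.toLin'OfInv (M := R.mat g) (M' := R.mat g⁻¹)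
    (by rw [← mat_mul, mul_inv_cancel, mat_one]) (by rw [← mat_mul, inv_mul_cancel, mat_one])
  refine (LinearEquiv.isSemisimple_iff _ _ c ?_).mp hs
  change Matrix.toLin' (R.mat g⁻¹) ∘ₗ Matrix.toLin' (R.mat s) =
    Matrix.toLin' (R.mat (g⁻¹ * s * g)) ∘ₗ Matrix.toLin' (R.mat g⁻¹)
  rw [← Matrix.toLin'_mul, ← Matrix.toLin'_mul, ← mat_mul, ← mat_mul, mul_inv_cancel_right]

theorem semiconjBy_mat_conj (u g : G) :
    SemiconjBy (R.mat g) (R.mat (g⁻¹ * u * g)) (R.mat u) := by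
  rw [SemiconjBy, ← mat_mul, ← mat_mul]
  congr 1
  group

variable {R} in
theorem IsUnipotent.conj {u : G} (hu : R.IsUnipotent u) (g : G) :
    R.IsUnipotent (g⁻¹ * u * g) := by
  obtain ⟨k, hk⟩ := hu
  have h := ((R.semiconjBy_mat_conj u g).sub_right (SemiconjBy.one_right _)).pow_right k
  rw [hk, SemiconjBy, zero_mul] at h
  exact ⟨k, (R.isUnit_mat g).mul_right_eq_zero.mp h⟩

variable {R} in
theorem IsJordanChevalley.conj {x s u : G} (h : R.IsJordanChevalley x s u) (g : G) :
    R.IsJordanChevalley (g⁻¹ * x * g) (g⁻¹ * s * g) (g⁻¹ * u * g) where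
  semisimple := h.semisimple.conj g
  unipotent := h.unipotent.conj g
  mul_eq := by rw [← h.mul_eq]; group
  comm := by
    have := h.comm.eq
    rw [commute_iff_eq]
    calc g⁻¹ * s * g * (g⁻¹ * u * g) = g⁻¹ * (s * u) * g := by group
      _ = g⁻¹ * u * g * (g⁻¹ * s * g) := by rw [this]; group

theorem unipotentPart_conj (x g : G) :
    R.unipotentPart (g⁻¹ * x * g) = g⁻¹ * R.unipotentPart x * g :=
  ((R.isJordanChevalley _).unique ((R.isJordanChevalley x).conj g)).2

theorem exists_isExpLog {u : G} (hu : R.IsUnipotent u) (c : ℂ) : ∃ g : G, R.IsExpLog c u g := by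
  obtain ⟨g, hg⟩ := R.exists_mat_eq_pow_mul_exp (s := 1) (g := u)
    (by rw [Matrix.toLin'_one]; exact Module.End.isSemisimple_id) isUnit_one hu
    (Commute.one_left _) (one_mul _).symm 0 c
  exact ⟨g, hu, by rw [hg, pow_zero, one_mul]⟩

open Classical in
/-- The element `exp (c log u)` of the group, for a unipotent element `u`; by convention it is
`1` if `u` is not unipotent. -/
noncomputable def expLog (c : ℂ) (u : G) : G :=
  if hu : R.IsUnipotent u then (R.exists_isExpLog hu c).choose else 1

variable {R} {u : G}

theorem IsUnipotent.isExpLog (hu : R.IsUnipotent u) (c : ℂ) : R.IsExpLog c u (R.expLog c u) := by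
  rw [expLog, dif_pos hu]
  exact (R.exists_isExpLog hu c).choose_spec

theorem IsUnipotent.mat_expLog (hu : R.IsUnipotent u) (c : ℂ) :
    R.mat (R.expLog c u) = NormedSpace.exp (c • unipotentLog (R.mat u)) := (hu.isExpLog c).2

theorem IsUnipotent.expLog_zero (hu : R.IsUnipotent u) : R.expLog 0 u = 1 :=
  R.mat_injective (by rw [hu.mat_expLog, zero_smul, NormedSpace.exp_zero, mat_one])

theorem IsUnipotent.expLog_one (hu : R.IsUnipotent u) : R.expLog 1 u = u :=
  R.mat_injective (by rw [hu.mat_expLog, one_smul, exp_unipotentLog hu])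

theorem IsUnipotent.expLog_add (hu : R.IsUnipotent u) (a b : ℂ) :
    R.expLog (a + b) u = R.expLog a u * R.expLog b u :=
  R.mat_injective (by simp only [mat_mul, hu.mat_expLog, exp_add_smul])

theorem IsUnipotent.expLog_neg_one (hu : R.IsUnipotent u) : R.expLog (-1) u = u⁻¹ := by
  refine eq_inv_of_mul_eq_one_left ?_
  have h := hu.expLog_add (-1) 1
  rw [neg_add_cancel, hu.expLog_zero, hu.expLog_one] at h
  exact h.symm

theorem IsUnipotent.expLog_conj (hu : R.IsUnipotent u) (c : ℂ) (g : G) :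
    R.expLog c (g⁻¹ * u * g) = g⁻¹ * R.expLog c u * g := by
  have h : g * R.expLog c (g⁻¹ * u * g) = R.expLog c u * g := by
    refine R.mat_injective ?_
    rw [mat_mul, mat_mul, (hu.conj g).mat_expLog, hu.mat_expLog, exp_smul_unipotentLog hu,
      exp_smul_unipotentLog (hu.conj g)]
    have hL := semiconjBy_unipotentLog (R.semiconjBy_mat_conj u g)
    rw [Finset.mul_sum, Finset.sum_mul]
    exact Finset.sum_congr rfl fun k _ => by
      rw [mul_smul_comm, smul_mul_assoc, (hL.pow_right k).eq]
  rw [mul_assoc _ (R.expLog c u), ← h, inv_mul_cancel_left]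

end LinearAlgebraicGroup

/-! ### Holomorphic maps into a linear algebraic group -/

namespace LinearAlgebraicGroup

open Filter Topology

variable {E : Type v} [NormedAddCommGroup E] [NormedSpace ℂ E]
  {G : Type w} [Group G] [TopologicalSpace G] [ChartedSpace E G] (R : LinearAlgebraicGroup E G)

open scoped Matrix.Norms.Operator in
theorem continuous_of_continuous_mat {X : Type*} [TopologicalSpace X] {h : X → G}
    (hh : ∀ i j, Continuous fun x => R.mat (h x) i j) : Continuous h := by
  rw [R.isEmbedding.continuous_iff]
  refine (Units.isOpenEmbedding_val
    (R := Matrix (Fin R.n) (Fin R.n) ℂ)).isEmbedding.continuous_iff.mpr ?_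
  exact continuous_pi fun i => continuous_pi fun j => hh i j

theorem continuous_mat : Continuous R.mat :=
  Units.continuous_val.comp R.isEmbedding.continuous

/-- The matrix of a group element as a point of the normed space of families of complex numbers. -/
def entries (g : G) : Fin R.n → Fin R.n → ℂ := fun i j => R.mat g i j

variable [FiniteDimensional ℂ E] [LieGroup 𝓘(ℂ, E) ω G]

/-- Near the identity, a chart of the group is a holomorphic function of the matrix: compose the
matrix representation with a linear left inverse of its (injective) differential, and apply the
inverse function theorem. -/
theorem exists_holomorphic_retraction :
    ∃ ψ : (Fin R.n → Fin R.n → ℂ) → E, ContDiffAt ℂ ω ψ (R.entries 1) ∧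
      ∀ᶠ g in 𝓝 (1 : G), ψ (R.entries g) = extChartAt 𝓘(ℂ, E) (1 : G) g := by
  have : IsManifold 𝓘(ℂ, E) ω G := LieGroup.toContMDiffMul.toIsManifold
  set φ := extChartAt 𝓘(ℂ, E) (1 : G) with hφ
  set F : E → (Fin R.n → Fin R.n → ℂ) := fun y => R.entries (φ.symm y) with hF
  have hsymm : ContMDiffAt 𝓘(ℂ, E) 𝓘(ℂ, E) ω φ.symm (φ 1) :=
    (contMDiffOn_extChartAt_symm (1 : G)).contMDiffAt (extChartAt_target_mem_nhds (1 : G))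
  have hFij : ∀ i j, ContDiffAt ℂ ω (fun y => F y i j) (φ 1) := fun i j =>
    ((R.holomorphic i j).contMDiffAt.comp (φ 1) hsymm).contDiffAt
  have hFdiff : ContDiffAt ℂ ω F (φ 1) :=
    contDiffAt_pi.mpr fun i => contDiffAt_pi.mpr fun j => hFij i j
  have hinj : ∀ x : E, fderiv ℂ F (φ 1) x = 0 → x = 0 := by
    intro x hx
    refine R.immersion x fun i j => ?_
    have hmd : MDifferentiableAt 𝓘(ℂ, E) 𝓘(ℂ)
        (fun g : G => (R.ρ g : Matrix (Fin R.n) (Fin R.n) ℂ) i j) 1 :=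
      (R.holomorphic i j).contMDiffAt.mdifferentiableAt (by simp)
    have hcomp : HasFDerivAt (fun y => F y i j)
        ((ContinuousLinearMap.proj j).comp ((ContinuousLinearMap.proj i).comp
          (fderiv ℂ F (φ 1)))) (φ 1) := by
      have h1 := (hFdiff.differentiableAt (by simp)).hasFDerivAt
      exact hasFDerivAt_pi'.mp (hasFDerivAt_pi'.mp h1 i) j
    have hm : mfderiv 𝓘(ℂ, E) 𝓘(ℂ)
        (fun g : G => (R.ρ g : Matrix (Fin R.n) (Fin R.n) ℂ) i j) 1 =
        fderiv ℂ (fun y => F y i j) (φ 1) := by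
      rw [hmd.mfderiv, ModelWithCorners.range_eq_univ, fderivWithin_univ]
      rfl
    rw [hm, hcomp.fderiv]
    change fderiv ℂ F (φ 1) x i j = 0
    rw [hx]
    rfl
  obtain ⟨L₀, hL₀⟩ := (fderiv ℂ F (φ 1)).toLinearMap.exists_leftInverse_of_injective
    (LinearMap.ker_eq_bot'.mpr hinj)
  let L : (Fin R.n → Fin R.n → ℂ) →L[ℂ] E := L₀.toContinuousLinearMap
  have hLF : ContDiffAt ℂ ω (fun y => L (F y)) (φ 1) := L.contDiff.contDiffAt.comp (φ 1) hFdiff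
  have hLF' : HasFDerivAt (fun y => L (F y))
      (ContinuousLinearEquiv.refl ℂ E : E →L[ℂ] E) (φ 1) := by
    have h1 := L.hasFDerivAt.comp (φ 1) (hFdiff.differentiableAt (by simp)).hasFDerivAt
    refine h1.congr_fderiv ?_
    ext x
    exact LinearMap.congr_fun hL₀ x
  have hF1 : F (φ 1) = R.entries 1 := by
    simp only [hF]
    rw [hφ, extChartAt_to_inv]
  have : CompleteSpace E := FiniteDimensional.complete ℂ E
  refine ⟨fun A => hLF.localInverse hLF' (by simp) (L A), ?_, ?_⟩
  · have h2 := hLF.to_localInverse hLF' (by simp)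
    rw [hF1] at h2
    exact h2.comp (R.entries 1) L.contDiff.contDiffAt
  · have h3 := (hLF.hasStrictFDerivAt' hLF' (by simp)).eventually_left_inverse
    have h4 : Tendsto φ (𝓝 1) (𝓝 (φ 1)) := continuousAt_extChartAt (1 : G)
    filter_upwards [h4.eventually h3, extChartAt_source_mem_nhds (I := 𝓘(ℂ, E)) (1 : G)]
      with g hg hg'
    rw [← hg]
    simp only [hF]
    rw [φ.left_inv hg']
    rfl

/-- A map to a linear algebraic group is holomorphic if the matrix entries are. -/
theorem contMDiff_of_contMDiff_mat {F H X : Type*} [NormedAddCommGroup F] [NormedSpace ℂ F]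
    [TopologicalSpace H] {I : ModelWithCorners ℂ F H} [TopologicalSpace X] [ChartedSpace H X]
    {h : X → G} (hh : ∀ i j, ContMDiff I 𝓘(ℂ) ω fun x => R.mat (h x) i j) :
    ContMDiff I 𝓘(ℂ, E) ω h := by
  obtain ⟨ψ, hψ, hψ'⟩ := R.exists_holomorphic_retraction
  have hcont := R.continuous_of_continuous_mat fun i j => (hh i j).continuous
  have : IsTopologicalGroup G := topologicalGroup_of_lieGroup 𝓘(ℂ, E) ω
  intro x₀
  set g₀ := h x₀ with hg₀
  -- translate by `g₀⁻¹` to a map which sends `x₀` to the identity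
  set h' : X → G := fun x => g₀⁻¹ * h x with hh'
  have h'x₀ : h' x₀ = 1 := inv_mul_cancel g₀
  have h'cont : Continuous h' := continuous_const.mul hcont
  have hmat : ContMDiffAt I 𝓘(ℂ, Fin R.n → Fin R.n → ℂ) ω
      (fun x => R.entries (h' x)) x₀ := by
    refine contMDiffAt_pi_space.mpr fun i => contMDiffAt_pi_space.mpr fun j => ?_
    have : (fun x => R.entries (h' x) i j) =
        fun x => ∑ l, R.mat g₀⁻¹ i l * R.mat (h x) l j := by
      funext x
      rw [entries, hh', mat_mul, Matrix.mul_apply]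
    rw [this]
    exact contMDiffAt_finsetSum fun l _ => contMDiffAt_const.mul (hh l j x₀)
  have h'diff : ContMDiffAt I 𝓘(ℂ, E) ω h' x₀ := by
    rw [contMDiffAt_iff_target]
    refine ⟨h'cont.continuousAt, ?_⟩
    rw [h'x₀]
    have h1 : ContMDiffAt I 𝓘(ℂ, E) ω (fun x => ψ (R.entries (h' x))) x₀ := by
      have h2 : ContMDiffAt 𝓘(ℂ, Fin R.n → Fin R.n → ℂ) 𝓘(ℂ, E) ω ψ (R.entries (h' x₀)) := by
        rw [h'x₀]
        exact hψ.contMDiffAt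
      exact h2.comp x₀ hmat
    refine h1.congr_of_eventuallyEq ?_
    have h3 : Tendsto h' (𝓝 x₀) (𝓝 1) := h'x₀ ▸ h'cont.tendsto x₀
    filter_upwards [h3.eventually hψ'] with x hx
    exact hx.symm
  have h4 : h = fun x => g₀ * h' x := by
    funext x
    rw [hh', mul_inv_cancel_left]
  rw [h4]
  exact contMDiffAt_const.mul h'diff

end LinearAlgebraicGroup

/-! ### Holomorphic families of group elements -/

section MatrixFamilies

variable {F H X : Type*} [NormedAddCommGroup F] [NormedSpace ℂ F] [TopologicalSpace H]
  [TopologicalSpace X] [ChartedSpace H X] {n : ℕ}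

/-- A matrix valued function is entrywise holomorphic if all its entries are. -/
def EntrywiseHolomorphic (I : ModelWithCorners ℂ F H) (A : X → Matrix (Fin n) (Fin n) ℂ) : Prop :=
  ∀ i j, ContMDiff I 𝓘(ℂ) ω fun x => A x i j

namespace EntrywiseHolomorphic

variable {I : ModelWithCorners ℂ F H} {A B : X → Matrix (Fin n) (Fin n) ℂ}

theorem const (C : Matrix (Fin n) (Fin n) ℂ) :
    EntrywiseHolomorphic I (fun _ : X => C) := fun _ _ => contMDiff_const

theorem sub (hA : EntrywiseHolomorphic I A) (hB : EntrywiseHolomorphic I B) :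
    EntrywiseHolomorphic I fun x => A x - B x := fun i j => (hA i j).sub (hB i j)

theorem mul (hA : EntrywiseHolomorphic I A) (hB : EntrywiseHolomorphic I B) :
    EntrywiseHolomorphic I fun x => A x * B x := fun i j => by
  simp only [Matrix.mul_apply]
  exact contMDiff_finsetSum fun l _ => (hA i l).mul (hB l j)

theorem pow (hA : EntrywiseHolomorphic I A) (k : ℕ) :
    EntrywiseHolomorphic I fun x => A x ^ k := by
  induction k with
  | zero => simpa using const 1
  | succ k ih =>
    simp only [pow_succ]
    exact ih.mul hA

theorem smul {c : X → ℂ} (hc : ContMDiff I 𝓘(ℂ) ω c) (hA : EntrywiseHolomorphic I A) :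
    EntrywiseHolomorphic I fun x => c x • A x := fun i j => hc.mul (hA i j)

theorem sum {ι : Type*} {s : Finset ι} {A : ι → X → Matrix (Fin n) (Fin n) ℂ}
    (hA : ∀ k ∈ s, EntrywiseHolomorphic I (A k)) :
    EntrywiseHolomorphic I fun x => ∑ k ∈ s, A k x := fun i j => by
  simp only [Matrix.sum_apply]
  exact contMDiff_finsetSum fun k hk => hA k hk i j

theorem aeval (hA : EntrywiseHolomorphic I A) (r : Polynomial ℂ) :
    EntrywiseHolomorphic I fun x => Polynomial.aeval (A x) r := by
  simp only [Polynomial.aeval_eq_sum_range]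
  exact sum fun k _ => smul contMDiff_const (hA.pow k)

theorem unipotentLog (hA : EntrywiseHolomorphic I A) :
    EntrywiseHolomorphic I fun x => unipotentLog (A x) :=
  sum fun k _ => smul contMDiff_const ((hA.sub (const 1)).pow (k + 1))

end EntrywiseHolomorphic

theorem semiconjBy_aeval {P A B : Matrix (Fin n) (Fin n) ℂ} (h : SemiconjBy P A B)
    (r : Polynomial ℂ) : SemiconjBy P (Polynomial.aeval A r) (Polynomial.aeval B r) := by
  rw [SemiconjBy, Polynomial.aeval_eq_sum_range, Polynomial.aeval_eq_sum_range, Finset.mul_sum,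
    Finset.sum_mul]
  exact Finset.sum_congr rfl fun k _ => by rw [mul_smul_comm, smul_mul_assoc, (h.pow_right k).eq]

end MatrixFamilies

namespace LinearAlgebraicGroup

variable {E : Type v} [NormedAddCommGroup E] [NormedSpace ℂ E] [FiniteDimensional ℂ E]
  {G : Type w} [Group G] [TopologicalSpace G] [ChartedSpace E G] [LieGroup 𝓘(ℂ, E) ω G]
  (R : LinearAlgebraicGroup E G)
  {F H X : Type*} [NormedAddCommGroup F] [NormedSpace ℂ F] [TopologicalSpace H]
  [TopologicalSpace X] [ChartedSpace H X] {I : ModelWithCorners ℂ F H}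

variable {R} in
omit [FiniteDimensional ℂ E] [LieGroup 𝓘(ℂ, E) ω G] in
theorem entrywiseHolomorphic_mat {m : X → G} (hm : ContMDiff I 𝓘(ℂ, E) ω m) :
    EntrywiseHolomorphic I fun x => R.mat (m x) := fun i j => (R.holomorphic i j).comp hm

theorem contMDiff_expLog {c : X → ℂ} {m : X → G} (hc : ContMDiff I 𝓘(ℂ) ω c)
    (hm : ContMDiff I 𝓘(ℂ, E) ω m) (hu : ∀ x, R.IsUnipotent (m x)) :
    ContMDiff I 𝓘(ℂ, E) ω fun x => R.expLog (c x) (m x) := by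
  refine R.contMDiff_of_contMDiff_mat ?_
  change EntrywiseHolomorphic I fun x => R.mat (R.expLog (c x) (m x))
  simp only [(hu _).mat_expLog, exp_smul_unipotentLog (hu _)]
  refine EntrywiseHolomorphic.sum fun k _ => EntrywiseHolomorphic.smul ?_
    ((entrywiseHolomorphic_mat hm).unipotentLog.pow k)
  exact (hc.pow k).mul contMDiff_const

omit [FiniteDimensional ℂ E] [LieGroup 𝓘(ℂ, E) ω G] [ChartedSpace H X] in
/-- In a continuous family whose members over a dense set are conjugate to each other, the
semisimple parts are the values of one polynomial at the members of the family. -/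
theorem exists_mat_semisimplePart_eq_aeval {m : X → G} (hm : Continuous m) {D : Set X}
    (hD : Dense D) {x₀ : X} (hconj : ∀ x ∈ D, ∃ g, m x = g⁻¹ * m x₀ * g) :
    ∃ r : Polynomial ℂ, ∀ x, R.mat (R.semisimplePart (m x)) = Polynomial.aeval (R.mat (m x)) r := by
  obtain ⟨r, q, k, hq, hrq, hk⟩ := exists_polynomial_semisimplePart (R.mat (m x₀))
  have hann : ∀ p : Polynomial ℂ, Polynomial.aeval (R.mat (m x₀)) p = 0 →
      ∀ x, Polynomial.aeval (R.mat (m x)) p = 0 := by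
    intro p hp x
    have hcl : IsClosed {x | Polynomial.aeval (R.mat (m x)) p = 0} :=
      isClosed_eq ((p.continuous_aeval).comp (R.continuous_mat.comp hm)) continuous_const
    have hsub : D ⊆ {x | Polynomial.aeval (R.mat (m x)) p = 0} := by
      intro x hx
      obtain ⟨g, hg⟩ := hconj x hx
      have h := semiconjBy_aeval (R.semiconjBy_mat_conj (m x₀) g) p
      rw [hp, SemiconjBy, zero_mul, ← hg] at h
      exact (R.isUnit_mat g).mul_right_eq_zero.mp h
    exact hcl.closure_subset_iff.mpr hsub (hD x)
  refine ⟨r, fun x => (R.isJordanChevalley (m x)).mat_semisimple_eq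
    (isSemisimple_toLin'_of_squarefree hq ?_) ⟨k, ?_⟩ ?_⟩
  · rw [← Polynomial.aeval_comp]
    exact hann _ (by rw [Polynomial.aeval_comp, hrq]) x
  · have h := hann ((Polynomial.X - r) ^ k) (by simpa using hk) x
    simpa using h
  · have h := (Polynomial.commute_X r).map (Polynomial.aeval (R := ℂ) (R.mat (m x)))
    rwa [Polynomial.aeval_X] at h

theorem contMDiff_unipotentPart {m : X → G} (hm : ContMDiff I 𝓘(ℂ, E) ω m) {D : Set X}
    (hD : Dense D) {x₀ : X} (hconj : ∀ x ∈ D, ∃ g, m x = g⁻¹ * m x₀ * g) :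
    ContMDiff I 𝓘(ℂ, E) ω fun x => R.unipotentPart (m x) := by
  obtain ⟨r, hr⟩ := R.exists_mat_semisimplePart_eq_aeval hm.continuous hD hconj
  have hs : ContMDiff I 𝓘(ℂ, E) ω fun x => R.semisimplePart (m x) := by
    refine R.contMDiff_of_contMDiff_mat ?_
    change EntrywiseHolomorphic I fun x => R.mat (R.semisimplePart (m x))
    simp only [hr]
    exact (entrywiseHolomorphic_mat hm).aeval r
  have h : (fun x => R.unipotentPart (m x)) = fun x => (R.semisimplePart (m x))⁻¹ * m x := by
    funext x
    exact eq_inv_mul_of_mul_eq (R.isJordanChevalley (m x)).mul_eq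
  rw [h]
  exact hs.inv.mul hm

end LinearAlgebraicGroup

/-! ### Equivariant maps of principal bundles -/

namespace PrincipalBundle

open Filter Topology

variable {E : Type v} [NormedAddCommGroup E] [NormedSpace ℂ E]
  {G : Type w} [Group G] [TopologicalSpace G] [ChartedSpace E G] (P : PrincipalBundle.{u} E G)

theorem smul_smul_right (p : P.carrier) (g h : G) : p <• g <• h = p <• (g * h) := by
  rw [smul_smul, ← MulOpposite.op_mul]

theorem smul_one_right (p : P.carrier) : p <• (1 : G) = p := by
  rw [MulOpposite.op_one, one_smul]

variable {P} in
theorem smul_right_injective (p : P.carrier) : Function.Injective fun g : G => p <• g := by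
  intro g h hgh
  obtain ⟨V, -, hV, e, hs, -, -, -, he⟩ := P.locally_trivial (P.proj p)
  have hp : p ∈ e.source := by rw [hs]; exact hV
  have h1 := congrArg (fun q => (e q).2) hgh
  simpa [(he p hp).2] using h1

theorem exists_smul_eq {p q : P.carrier} (h : P.proj q = P.proj p) : ∃ g : G, p <• g = q := by
  obtain ⟨V, -, hV, e, hs, -, -, -, he⟩ := P.locally_trivial (P.proj p)
  have hp : p ∈ e.source := by rw [hs]; exact hV
  have hq : q ∈ e.source := by rw [hs, Set.mem_preimage, h]; exact hV
  have hpg : p <• ((e p).2⁻¹ * (e q).2) ∈ e.source := by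
    rw [hs, Set.mem_preimage, P.proj_smul]; exact hV
  refine ⟨(e p).2⁻¹ * (e q).2, e.injOn hpg hq ?_⟩
  rw [(he p hp).2]
  exact Prod.ext (((he p hp).1.trans h.symm).trans (he q hq).1.symm) (by simp)

/-- The element `g` of the group with `p <• g = q`, for points `p` and `q` of one fibre. -/
noncomputable def div (p q : P.carrier) : G := Classical.epsilon fun g => p <• g = q

variable {P}

theorem smul_div {p q : P.carrier} (h : P.proj q = P.proj p) : p <• P.div p q = q :=
  Classical.epsilon_spec (P.exists_smul_eq h)

theorem div_smul (p : P.carrier) (g : G) : P.div p (p <• g) = g :=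
  smul_right_injective p (smul_div (P.proj_smul p g))

/-- In a trivialization, division is the division of the group components. -/
theorem div_eq_of_trivialization {e : OpenPartialHomeomorph P.carrier (ℂ × G)}
    (he : ∀ p ∈ e.source, (e p).1 = P.proj p ∧ ∀ g : G, e (p <• g) = ((e p).1, (e p).2 * g))
    {p q : P.carrier} (hp : p ∈ e.source) (h : P.proj q = P.proj p) :
    P.div p q = (e p).2⁻¹ * (e q).2 := by
  have h1 := (he p hp).2 (P.div p q)
  rw [smul_div h] at h1
  rw [h1, inv_mul_cancel_left]

theorem dense_proj_ne_zero : Dense {p : P.carrier | P.proj p ≠ 0} := by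
  intro p
  by_cases hp0 : P.proj p = 0
  swap
  · exact subset_closure hp0
  obtain ⟨V, hVo, hV, e, hs, ht, -, -, he⟩ := P.locally_trivial (P.proj p)
  have hp : p ∈ e.source := by rw [hs]; exact hV
  have hlim : Tendsto (fun t : ℂ => e.symm (t, (e p).2)) (𝓝[≠] 0) (𝓝 p) := by
    have h1 : ContinuousAt e.symm (0, (e p).2) := by
      refine e.symm.continuousAt ?_
      rw [e.symm_source, ht]
      exact ⟨hp0 ▸ hV, trivial⟩
    have h2 : e.symm (0, (e p).2) = p := by
      rw [← hp0, ← (he p hp).1]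
      exact e.left_inv hp
    have h3 : Tendsto (fun t : ℂ => (t, (e p).2)) (𝓝 0) (𝓝 (0, (e p).2)) :=
      Continuous.tendsto (by fun_prop) 0
    have h4 := h1.tendsto.comp h3
    rw [h2] at h4
    exact h4.mono_left nhdsWithin_le_nhds
  refine mem_closure_of_tendsto hlim ?_
  filter_upwards [nhdsWithin_le_nhds (hVo.mem_nhds (hp0 ▸ hV)), self_mem_nhdsWithin] with t htV ht0
  have htt : (t, (e p).2) ∈ e.target := by rw [ht]; exact ⟨htV, trivial⟩
  have h1 := (he _ (e.map_target htt)).1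
  rw [e.right_inv htt] at h1
  exact h1 ▸ ht0

variable [LieGroup 𝓘(ℂ, E) ω G]
  {F H X : Type*} [NormedAddCommGroup F] [NormedSpace ℂ F] [TopologicalSpace H]
  [TopologicalSpace X] [ChartedSpace H X] {I : ModelWithCorners ℂ F H}

theorem contMDiff_smul {f : X → P.carrier} {h : X → G}
    (hf : ContMDiff I (𝓘(ℂ).prod 𝓘(ℂ, E)) ω f) (hh : ContMDiff I 𝓘(ℂ, E) ω h) :
    ContMDiff I (𝓘(ℂ).prod 𝓘(ℂ, E)) ω fun x => f x <• h x := by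
  intro x₀
  obtain ⟨V, hVo, hV, e, hs, ht, hes, het, he⟩ := P.locally_trivial (P.proj (f x₀))
  have hx₀ : f x₀ ∈ e.source := by rw [hs]; exact hV
  have hnear : ∀ᶠ x in 𝓝 x₀, f x ∈ e.source :=
    hf.continuous.continuousAt.eventually (e.open_source.mem_nhds hx₀)
  have h1 : ContMDiffAt I (𝓘(ℂ).prod 𝓘(ℂ, E)) ω (fun x => e (f x)) x₀ :=
    (hes.contMDiffAt (e.open_source.mem_nhds hx₀)).comp x₀ (hf x₀)
  have h2 : ContMDiffAt I (𝓘(ℂ).prod 𝓘(ℂ, E)) ω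
      (fun x => ((e (f x)).1, (e (f x)).2 * h x)) x₀ :=
    h1.fst.prodMk (h1.snd.mul (hh x₀))
  have hmem : ((e (f x₀)).1, (e (f x₀)).2 * h x₀) ∈ e.target := by
    rw [ht, (he _ hx₀).1]
    exact ⟨hV, trivial⟩
  have h3 : ContMDiffAt I (𝓘(ℂ).prod 𝓘(ℂ, E)) ω
      (fun x => e.symm ((e (f x)).1, (e (f x)).2 * h x)) x₀ :=
    ContMDiffAt.comp x₀ (het.contMDiffAt (e.open_target.mem_nhds hmem)) h2
  refine h3.congr_of_eventuallyEq ?_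
  filter_upwards [hnear] with x hx
  have hx' : f x <• h x ∈ e.source := by
    rw [hs, Set.mem_preimage, P.proj_smul]
    rwa [hs] at hx
  rw [← (he _ hx).2, e.left_inv hx']

theorem contMDiff_div {f f' : X → P.carrier} (hf : ContMDiff I (𝓘(ℂ).prod 𝓘(ℂ, E)) ω f)
    (hf' : ContMDiff I (𝓘(ℂ).prod 𝓘(ℂ, E)) ω f') (h : ∀ x, P.proj (f' x) = P.proj (f x)) :
    ContMDiff I 𝓘(ℂ, E) ω fun x => P.div (f x) (f' x) := by
  intro x₀
  obtain ⟨V, hVo, hV, e, hs, -, hes, -, he⟩ := P.locally_trivial (P.proj (f x₀))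
  have hx₀ : f x₀ ∈ e.source := by rw [hs]; exact hV
  have hx₀' : f' x₀ ∈ e.source := by rw [hs, Set.mem_preimage, h]; exact hV
  have hnear : ∀ᶠ x in 𝓝 x₀, f x ∈ e.source :=
    hf.continuous.continuousAt.eventually (e.open_source.mem_nhds hx₀)
  have h1 : ContMDiffAt I (𝓘(ℂ).prod 𝓘(ℂ, E)) ω (fun x => e (f x)) x₀ :=
    (hes.contMDiffAt (e.open_source.mem_nhds hx₀)).comp x₀ (hf x₀)
  have h2 : ContMDiffAt I (𝓘(ℂ).prod 𝓘(ℂ, E)) ω (fun x => e (f' x)) x₀ :=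
    (hes.contMDiffAt (e.open_source.mem_nhds hx₀')).comp x₀ (hf' x₀)
  have h3 : ContMDiffAt I 𝓘(ℂ, E) ω (fun x => (e (f x)).2⁻¹ * (e (f' x)).2) x₀ :=
    h1.snd.inv.mul h2.snd
  refine h3.congr_of_eventuallyEq ?_
  filter_upwards [hnear] with x hx
  exact div_eq_of_trivialization he hx (h x)

end PrincipalBundle

/-! ### The holonomy of a representation -/

section Holonomy

variable {E : Type v} [NormedAddCommGroup E] [NormedSpace ℂ E]
  {G : Type w} [Group G] [TopologicalSpace G] [ChartedSpace E G] {P : PrincipalBundle.{u} E G}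

namespace Representation

variable (Φ : Representation P)

theorem proj_monodromy (p : P.carrier) : P.proj (Φ.monodromy p) = P.proj p := by
  rw [monodromy, Φ.proj_act, Complex.exp_two_pi_mul_I, one_mul]

/-- The monodromy at `P.proj p` as an element of `G`, the automorphism group of the fibre being
identified with `G` by means of the point `p`. -/
noncomputable def holonomy (p : P.carrier) : G := P.div p (Φ.monodromy p)

theorem smul_holonomy (p : P.carrier) : p <• Φ.holonomy p = Φ.monodromy p :=
  PrincipalBundle.smul_div (Φ.proj_monodromy p)

variable {Φ} in
theorem holonomy_eq {p : P.carrier} {g : G} (h : Φ.monodromy p = p <• g) : Φ.holonomy p = g :=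
  PrincipalBundle.smul_right_injective p ((Φ.smul_holonomy p).trans h)

theorem holonomy_smul (p : P.carrier) (g : G) :
    Φ.holonomy (p <• g) = g⁻¹ * Φ.holonomy p * g := by
  apply holonomy_eq
  rw [monodromy, Φ.act_smul, ← monodromy, ← smul_holonomy, P.smul_smul_right, P.smul_smul_right]
  congr 2
  group

theorem holonomy_act (t : ℂ) (p : P.carrier) : Φ.holonomy (Φ.act t p) = Φ.holonomy p := by
  apply holonomy_eq
  rw [← Φ.act_smul, smul_holonomy, monodromy, ← Φ.act_add, ← Φ.act_add, add_comm]

/-- Away from the fibre over `0`, which is a single orbit of the groupoid, the holonomy runs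
through one conjugacy class. -/
theorem exists_holonomy_eq_conj {p q : P.carrier} (hp : P.proj p ≠ 0) (hq : P.proj q ≠ 0) :
    ∃ g : G, Φ.holonomy q = g⁻¹ * Φ.holonomy p * g := by
  have h : P.proj q = P.proj (Φ.act (Complex.log (P.proj q / P.proj p)) p) := by
    rw [Φ.proj_act, Complex.exp_log (div_ne_zero hq hp), div_mul_cancel₀ _ hp]
  obtain ⟨g, hg⟩ := P.exists_smul_eq h
  exact ⟨g, by rw [← hg, holonomy_smul, holonomy_act]⟩

variable [LieGroup 𝓘(ℂ, E) ω G]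

theorem contMDiff_holonomy : ContMDiff (𝓘(ℂ).prod 𝓘(ℂ, E)) 𝓘(ℂ, E) ω Φ.holonomy :=
  PrincipalBundle.contMDiff_div contMDiff_id
    (Φ.holomorphic.comp (contMDiff_const.prodMk contMDiff_id)) Φ.proj_monodromy

end Representation

theorem PrincipalBundle.exists_proj_ne_zero (P : PrincipalBundle.{u} E G) :
    ∃ p : P.carrier, P.proj p ≠ 0 := by
  obtain ⟨V, -, hV, e, hs, ht, -, -, he⟩ := P.locally_trivial 1
  have h : ((1 : ℂ), (1 : G)) ∈ e.target := by rw [ht]; exact ⟨hV, trivial⟩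
  refine ⟨e.symm (1, 1), ?_⟩
  rw [← (he _ (e.map_target h)).1, e.right_inv h]
  exact one_ne_zero

end Holonomy

/-! ### Unipotent automorphisms and the cocycles they define -/

section UnipotentAutomorphisms

variable {E : Type v} [NormedAddCommGroup E] [NormedSpace ℂ E]
  {G : Type w} [Group G] [TopologicalSpace G] [ChartedSpace E G]

/-- A unipotent automorphism `p ↦ p <• val p` of a representation, described by the equivariant
function `val` on the total space with values in the unipotent elements of `G`. -/
structure UnipotentField (R : LinearAlgebraicGroup E G) {P : PrincipalBundle.{u} E G}
    (Φ : Representation P) where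
  /-- the value of the automorphism at a point -/
  val : P.carrier → G
  val_smul : ∀ (p : P.carrier) (g : G), val (p <• g) = g⁻¹ * val p * g
  val_act : ∀ (t : ℂ) (p : P.carrier), val (Φ.act t p) = val p
  holomorphic : ContMDiff (𝓘(ℂ).prod 𝓘(ℂ, E)) 𝓘(ℂ, E) ω val
  unipotent : ∀ p, R.IsUnipotent (val p)

namespace UnipotentField

variable {R : LinearAlgebraicGroup E G} {P : PrincipalBundle.{u} E G} {Φ : Representation P}

/-- Translation by `exp (c log u)` does not change the value `u`, with which it commutes. -/
theorem val_smul_expLog (U : UnipotentField R Φ) (c : ℂ) (p : P.carrier) :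
    U.val (p <• R.expLog c (U.val p)) = U.val p := by
  have hu := U.unipotent p
  have h : R.expLog c (U.val p) * U.val p = U.val p * R.expLog c (U.val p) := by
    calc R.expLog c (U.val p) * U.val p = R.expLog c (U.val p) * R.expLog 1 (U.val p) := by
          rw [hu.expLog_one]
      _ = R.expLog 1 (U.val p) * R.expLog c (U.val p) := by
          rw [← hu.expLog_add, add_comm, hu.expLog_add]
      _ = U.val p * R.expLog c (U.val p) := by rw [hu.expLog_one]
  rw [U.val_smul, mul_assoc, ← h, inv_mul_cancel_left]

variable [LieGroup 𝓘(ℂ, E) ω G]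

/-- The automorphism `p ↦ p <• val p` of the representation. -/
noncomputable def aut (U : UnipotentField R Φ) : (⟨P, Φ⟩ : RepObj.{u} E G) ≅ ⟨P, Φ⟩ where
  hom :=
    { hom :=
      { toFun := fun p => p <• U.val p
        proj_toFun := fun p => P.proj_smul p _
        map_smul := fun p g => by
          rw [P.smul_smul_right, P.smul_smul_right, U.val_smul]
          congr 2
          group
        holomorphic := PrincipalBundle.contMDiff_smul contMDiff_id U.holomorphic }
      comm := fun t p => by
        change Φ.act t p <• _ = Φ.act t (p <• _)
        rw [U.val_act, Φ.act_smul] }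
  inv :=
    { hom :=
      { toFun := fun p => p <• (U.val p)⁻¹
        proj_toFun := fun p => P.proj_smul p _
        map_smul := fun p g => by
          rw [P.smul_smul_right, P.smul_smul_right, U.val_smul]
          congr 2
          group
        holomorphic := PrincipalBundle.contMDiff_smul contMDiff_id U.holomorphic.inv }
      comm := fun t p => by
        change Φ.act t p <• _ = Φ.act t (p <• _)
        rw [U.val_act, Φ.act_smul] }
  hom_inv_id := by
    refine RepHom.ext (BundleHom.ext (funext fun p => ?_))
    change (p <• U.val p) <• (U.val (p <• U.val p))⁻¹ = p
    rw [U.val_smul, P.smul_smul_right, inv_mul_cancel, one_mul, mul_inv_cancel, P.smul_one_right]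
  inv_hom_id := by
    refine RepHom.ext (BundleHom.ext (funext fun p => ?_))
    change (p <• (U.val p)⁻¹) <• U.val (p <• (U.val p)⁻¹) = p
    rw [U.val_smul, P.smul_smul_right, inv_inv, mul_inv_cancel_right, inv_mul_cancel,
      P.smul_one_right]

theorem isUnipotentMap_aut (U : UnipotentField R Φ) : IsUnipotentMap R U.aut.hom.hom.toFun :=
  fun p => ⟨U.val p, rfl, U.unipotent p⟩

/-- The equivariant function that describes a given unipotent automorphism. -/
noncomputable def ofAut (U : (⟨P, Φ⟩ : RepObj.{u} E G) ≅ ⟨P, Φ⟩)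
    (hU : IsUnipotentMap R U.hom.hom.toFun) : UnipotentField R Φ where
  val p := P.div p (U.hom.hom.toFun p)
  val_smul p g := by
    obtain ⟨u, hu, -⟩ := hU p
    rw [U.hom.hom.map_smul, hu, PrincipalBundle.div_smul]
    have h : p <• u <• g = p <• g <• (g⁻¹ * u * g) := by
      rw [P.smul_smul_right, P.smul_smul_right]
      congr 2
      group
    rw [h, PrincipalBundle.div_smul]
  val_act t p := by
    obtain ⟨u, hu, -⟩ := hU p
    have h : U.hom.hom.toFun (Φ.act t p) = Φ.act t (U.hom.hom.toFun p) := U.hom.comm t p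
    rw [h, hu, Φ.act_smul, PrincipalBundle.div_smul, PrincipalBundle.div_smul]
  holomorphic := PrincipalBundle.contMDiff_div contMDiff_id U.hom.hom.holomorphic
    U.hom.hom.proj_toFun
  unipotent p := by
    obtain ⟨u, hu, hu'⟩ := hU p
    rwa [hu, PrincipalBundle.div_smul]

theorem smul_val_ofAut (U : (⟨P, Φ⟩ : RepObj.{u} E G) ≅ ⟨P, Φ⟩)
    (hU : IsUnipotentMap R U.hom.hom.toFun) (p : P.carrier) :
    p <• (ofAut U hU).val p = U.hom.hom.toFun p :=
  PrincipalBundle.smul_div (U.hom.hom.proj_toFun p)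

theorem val_ofAut_aut (U : UnipotentField R Φ) (hU : IsUnipotentMap R U.aut.hom.hom.toFun) :
    (ofAut U.aut hU).val = U.val :=
  funext fun p => PrincipalBundle.div_smul p (U.val p)

variable [FiniteDimensional ℂ E]

/-- The cocycle `σ(t, z) = exp (t c log U(exp t * z))` attached to a unipotent automorphism `U`
and a complex number `c`. -/
noncomputable def cocycle (U : UnipotentField R Φ) (c : ℂ) : Cocycle Φ where
  toFun t q := q <• R.expLog (t * c) (U.val q)
  proj_toFun t q := P.proj_smul q _
  map_smul t q g := by
    rw [U.val_smul, (U.unipotent q).expLog_conj, P.smul_smul_right, P.smul_smul_right]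
    congr 2
    group
  holomorphic := PrincipalBundle.contMDiff_smul contMDiff_snd
    (R.contMDiff_expLog (contMDiff_fst.mul contMDiff_const) (U.holomorphic.comp contMDiff_snd)
      fun x => U.unipotent x.2)
  cocycle μ t q := by
    rw [U.val_act μ (q <• _), U.val_smul_expLog, Φ.act_smul, P.smul_smul_right, U.val_act,
      ← (U.unipotent q).expLog_add, add_mul, add_comm]

theorem twist_act (U : UnipotentField R Φ) (c t : ℂ) (p : P.carrier) :
    (U.cocycle c).twist.act t p = Φ.act t p <• R.expLog (t * c) (U.val p) := by
  change Φ.act t p <• R.expLog (t * c) (U.val (Φ.act t p)) = _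
  rw [U.val_act]

theorem isExpLogMap_cocycle (U : UnipotentField R Φ) (c t : ℂ) :
    IsExpLogMap R (t * c) (fun p => p <• U.val p) ((U.cocycle c).toFun t) := fun p =>
  ⟨U.val p, R.expLog (t * c) (U.val p), rfl, (U.unipotent p).isExpLog _, rfl⟩

/-- The automorphism `U`, as an automorphism of the twist of the representation by one of the
cocycles attached to `U`. -/
noncomputable def twist (U : UnipotentField R Φ) (c : ℂ) :
    UnipotentField R (U.cocycle c).twist where
  val := U.val
  val_smul := U.val_smul
  val_act t p := by
    rw [U.twist_act, ← U.val_act t p, U.val_smul_expLog]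
  holomorphic := U.holomorphic
  unipotent := U.unipotent

/-- Twisting by the cocycles with parameters `c` and `-c` are inverse operations. -/
theorem twist_twist (U : UnipotentField R Φ) {c d : ℂ} (hcd : c + d = 0)
    (U' : UnipotentField R (U.cocycle c).twist) (hU' : U'.val = U.val) :
    (U'.cocycle d).twist = Φ := by
  refine Representation.ext (funext fun t => funext fun p => ?_)
  rw [U'.twist_act, U.twist_act, hU', P.smul_smul_right, ← (U.unipotent p).expLog_add, ← mul_add,
    hcd, mul_zero, (U.unipotent p).expLog_zero, P.smul_one_right]

theorem holonomy_twist (U : UnipotentField R Φ) (c : ℂ) (p : P.carrier) :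
    (U.cocycle c).twist.holonomy p =
      Φ.holonomy p * R.expLog (2 * Real.pi * Complex.I * c) (U.val p) := by
  apply Representation.holonomy_eq
  rw [Representation.monodromy, U.twist_act, ← Representation.monodromy, ← Φ.smul_holonomy,
    P.smul_smul_right]

omit [LieGroup 𝓘(ℂ, E) ω G] [FiniteDimensional ℂ E] in
/-- The holonomy commutes with the automorphism. -/
theorem commute_holonomy (U : UnipotentField R Φ) (p : P.carrier) :
    Commute (Φ.holonomy p) (U.val p) := by
  have h := U.val_act (2 * Real.pi * Complex.I) p
  rw [← Representation.monodromy, ← Φ.smul_holonomy, U.val_smul, mul_assoc,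
    inv_mul_eq_iff_eq_mul] at h
  exact h.symm

theorem twist_comm {Q : PrincipalBundle.{u} E G} {Ψ : Representation Q}
    (U : UnipotentField R Φ) (U' : UnipotentField R Ψ) (c : ℂ) (f : BundleHom P Q)
    (hf : ∀ t p, f.toFun (Φ.act t p) = Ψ.act t (f.toFun p))
    (hU : ∀ p, U'.val (f.toFun p) = U.val p) (t : ℂ) (p : P.carrier) :
    f.toFun ((U.cocycle c).twist.act t p) = (U'.cocycle c).twist.act t (f.toFun p) := by
  rw [U.twist_act, U'.twist_act, f.map_smul, hf, hU]

/-- The unipotent part of the monodromy. It is holomorphic also at the fibre over `0`, because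
the monodromy is generically contained in one conjugacy class. -/
noncomputable def ofMonodromy (R : LinearAlgebraicGroup E G) {P : PrincipalBundle.{u} E G}
    (Φ : Representation P) : UnipotentField R Φ where
  val p := R.unipotentPart (Φ.holonomy p)
  val_smul p g := by rw [Φ.holonomy_smul, R.unipotentPart_conj]
  val_act t p := by rw [Φ.holonomy_act]
  holomorphic := by
    obtain ⟨p₀, hp₀⟩ := P.exists_proj_ne_zero
    exact R.contMDiff_unipotentPart Φ.contMDiff_holonomy PrincipalBundle.dense_proj_ne_zero
      fun p hp => Φ.exists_holonomy_eq_conj hp₀ hp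
  unipotent p := (R.isJordanChevalley _).unipotent

theorem isUnipotentPart_ofMonodromy :
    IsUnipotentPart R Φ.monodromy fun p => p <• (ofMonodromy R Φ).val p := fun p =>
  ⟨Φ.holonomy p, R.semisimplePart _, R.unipotentPart _, (Φ.smul_holonomy p).symm,
    R.isJordanChevalley _, rfl⟩

/-- The cocycle with parameter `-1 / (2πi)` removes the unipotent part of the monodromy. -/
theorem hasSemisimpleMonodromy_twist {c : ℂ} (hc : 2 * Real.pi * Complex.I * c = -1) :
    HasSemisimpleMonodromy R ((ofMonodromy R Φ).cocycle c).twist := by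
  intro p _
  refine ⟨_, (Representation.smul_holonomy _ p).symm, ?_⟩
  have h := R.isJordanChevalley (Φ.holonomy p)
  have hval : (ofMonodromy R Φ).val p = R.unipotentPart (Φ.holonomy p) := rfl
  rw [holonomy_twist, hc, ((ofMonodromy R Φ).unipotent p).expLog_neg_one, hval,
    ← eq_mul_inv_of_mul_eq h.mul_eq]
  exact h.semisimple

/-- The cocycle with parameter `1 / (2πi)` multiplies a semisimple monodromy by `U`, which is then
the unipotent part of the new monodromy: away from the fibre over `0` by uniqueness of the
Jordan-Chevalley decomposition, and on this fibre by continuity. -/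
theorem val_ofMonodromy_twist (U : UnipotentField R Φ) (hΦ : HasSemisimpleMonodromy R Φ) {c : ℂ}
    (hc : 2 * Real.pi * Complex.I * c = 1) :
    (ofMonodromy R (U.cocycle c).twist).val = U.val := by
  have : T2Space G :=
    T2Space.of_injective_continuous R.mat_injective R.continuous_mat
  refine (ofMonodromy R _).holomorphic.continuous.ext_on PrincipalBundle.dense_proj_ne_zero
    U.holomorphic.continuous fun p hp => ?_
  obtain ⟨s, hs, hss⟩ := hΦ p hp
  have hhol := Representation.holonomy_eq hs
  have hJC : R.IsJordanChevalley ((U.cocycle c).twist.holonomy p) s (U.val p) :=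
    { semisimple := hss
      unipotent := U.unipotent p
      mul_eq := by rw [holonomy_twist, hc, (U.unipotent p).expLog_one, hhol]
      comm := hhol ▸ U.commute_holonomy p }
  exact ((R.isJordanChevalley _).unique hJC).2

end UnipotentField

end UnipotentAutomorphisms

/-! ### The two functors -/

section Functors

variable {E : Type v} [NormedAddCommGroup E] [NormedSpace ℂ E]
  {G : Type w} [Group G] [TopologicalSpace G] [ChartedSpace E G]

theorem JCObj.eq_of_toFun_eq {R : LinearAlgebraicGroup E G} {P : PrincipalBundle.{u} E G}
    {Ψ Ψ' : Representation P} (h : Ψ = Ψ') {hss : HasSemisimpleMonodromy R Ψ}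
    {hss' : HasSemisimpleMonodromy R Ψ'} {U : (⟨P, Ψ⟩ : RepObj.{u} E G) ≅ ⟨P, Ψ⟩}
    {U' : (⟨P, Ψ'⟩ : RepObj.{u} E G) ≅ ⟨P, Ψ'⟩} {hU : IsUnipotentMap R U.hom.hom.toFun}
    {hU' : IsUnipotentMap R U'.hom.hom.toFun} (hUU' : U.hom.hom.toFun = U'.hom.hom.toFun) :
    (⟨⟨P, Ψ⟩, hss, U, hU⟩ : JCObj.{u} R) = ⟨⟨P, Ψ'⟩, hss', U', hU'⟩ := by
  subst h
  obtain rfl : U = U' := Iso.ext (RepHom.ext (BundleHom.ext hUU'))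
  rfl

theorem RepHom.heq_of_hom_eq {P Q : PrincipalBundle.{u} E G} {Φ Φ' : Representation P}
    {Ψ Ψ' : Representation Q} (hΦ : Φ = Φ') (hΨ : Ψ = Ψ')
    {f : (⟨P, Φ⟩ : RepObj.{u} E G) ⟶ ⟨Q, Ψ⟩} {f' : (⟨P, Φ'⟩ : RepObj.{u} E G) ⟶ ⟨Q, Ψ'⟩}
    (h : f.hom = f'.hom) : f ≍ f' := by
  subst hΦ hΨ
  exact heq_of_eq (RepHom.ext h)

theorem JCHom.heq_of_hom_eq {R : LinearAlgebraicGroup E G} {X X' Y Y' : JCObj.{u} R}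
    (hX : X = X') (hY : Y = Y') {f : X ⟶ Y} {f' : X' ⟶ Y'}
    (h : f.hom.hom.toFun ≍ f'.hom.hom.toFun) : f ≍ f' := by
  subst hX hY
  exact heq_of_eq (JCHom.ext (RepHom.ext (BundleHom.ext (eq_of_heq h))))

variable [FiniteDimensional ℂ E] [LieGroup 𝓘(ℂ, E) ω G]

open UnipotentField

theorem val_ofMonodromy_map (R : LinearAlgebraicGroup E G) {X Y : RepObj.{u} E G} (f : X ⟶ Y)
    (p : X.bundle.carrier) :
    (ofMonodromy R Y.rep).val (f.hom.toFun p) = (ofMonodromy R X.rep).val p := by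
  have h : Y.rep.holonomy (f.hom.toFun p) = X.rep.holonomy p := by
    apply Representation.holonomy_eq
    rw [← f.hom.map_smul, X.rep.smul_holonomy]
    exact (f.comm _ p).symm
  exact congrArg R.unipotentPart h

omit [FiniteDimensional ℂ E] in
theorem val_ofAut_map {R : LinearAlgebraicGroup E G} {X Y : JCObj.{u} R} (f : X ⟶ Y)
    (p : X.base.bundle.carrier) :
    (ofAut Y.aut Y.unipotent).val (f.hom.hom.toFun p) = (ofAut X.aut X.unipotent).val p := by
  apply PrincipalBundle.smul_right_injective (f.hom.hom.toFun p)
  have h : f.hom.hom.toFun (X.aut.hom.hom.toFun p) = Y.aut.hom.hom.toFun (f.hom.hom.toFun p) :=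
    congrArg (fun g : X.base ⟶ Y.base => g.hom.toFun p) f.comm
  change _ <• (ofAut Y.aut Y.unipotent).val _ = _ <• (ofAut X.aut X.unipotent).val p
  rw [smul_val_ofAut, ← f.hom.hom.map_smul, smul_val_ofAut, h]

/-- The functor that splits off the unipotent part of the monodromy: the representation is twisted
by `exp (t c log M_u)`, where `2πi c = -1`. -/
noncomputable def jordanFunctor (R : LinearAlgebraicGroup E G) {c : ℂ}
    (hc : 2 * Real.pi * Complex.I * c = -1) : RepObj.{u} E G ⥤ JCObj.{u} R where
  obj X :=
    { base := ⟨X.bundle, ((ofMonodromy R X.rep).cocycle c).twist⟩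
      semisimple := hasSemisimpleMonodromy_twist hc
      aut := ((ofMonodromy R X.rep).twist c).aut
      unipotent := isUnipotentMap_aut _ }
  map {X Y} f :=
    { hom := ⟨f.hom, twist_comm _ _ c f.hom f.comm (val_ofMonodromy_map R f)⟩
      comm := by
        refine RepHom.ext (BundleHom.ext (funext fun p => ?_))
        change f.hom.toFun (p <• (ofMonodromy R X.rep).val p) =
          f.hom.toFun p <• (ofMonodromy R Y.rep).val (f.hom.toFun p)
        rw [f.hom.map_smul, val_ofMonodromy_map] }

/-- The functor that absorbs a unipotent automorphism `U` into the representation: the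
representation is twisted by `exp (t c log U)`. -/
noncomputable def absorbFunctor (R : LinearAlgebraicGroup E G) (c : ℂ) :
    JCObj.{u} R ⥤ RepObj.{u} E G where
  obj Y := ⟨Y.base.bundle, ((ofAut Y.aut Y.unipotent).cocycle c).twist⟩
  map f := ⟨f.hom.hom, twist_comm _ _ c f.hom.hom f.hom.comm (val_ofAut_map f)⟩

theorem rep_absorbFunctor_jordanFunctor (R : LinearAlgebraicGroup E G) {c d : ℂ}
    (hc : 2 * Real.pi * Complex.I * c = -1) (hcd : c + d = 0) (X : RepObj.{u} E G) :
    ((ofAut ((jordanFunctor R hc).obj X).aut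
      ((jordanFunctor R hc).obj X).unipotent).cocycle d).twist = X.rep :=
  twist_twist (ofMonodromy R X.rep) hcd _ (val_ofAut_aut _ _)

theorem jordanFunctor_comp_absorbFunctor (R : LinearAlgebraicGroup E G) {c d : ℂ}
    (hc : 2 * Real.pi * Complex.I * c = -1) (hcd : c + d = 0) :
    jordanFunctor R hc ⋙ absorbFunctor R d = 𝟭 (RepObj.{u} E G) := by
  refine Functor.hext (fun X => ?_) fun X Y f => ?_
  · exact congrArg (RepObj.mk X.bundle) (rep_absorbFunctor_jordanFunctor R hc hcd X)
  · exact RepHom.heq_of_hom_eq (rep_absorbFunctor_jordanFunctor R hc hcd X)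
      (rep_absorbFunctor_jordanFunctor R hc hcd Y) rfl

theorem jordanFunctor_obj_absorbFunctor_obj (R : LinearAlgebraicGroup E G) {c d : ℂ}
    (hc : 2 * Real.pi * Complex.I * c = -1) (hcd : c + d = 0) (Y : JCObj.{u} R) :
    (jordanFunctor R hc).obj ((absorbFunctor R d).obj Y) = Y := by
  have hd : 2 * Real.pi * Complex.I * d = 1 := by
    rw [← neg_eq_of_add_eq_zero_right hcd, mul_neg, hc, neg_neg]
  have hval := val_ofMonodromy_twist (ofAut Y.aut Y.unipotent) Y.semisimple hd
  refine JCObj.eq_of_toFun_eq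
    (twist_twist (ofAut Y.aut Y.unipotent) ((add_comm d c).trans hcd) _ hval) ?_
  exact funext fun p =>
    (congrArg (fun v => p <• v p) hval).trans (smul_val_ofAut Y.aut Y.unipotent p)

theorem absorbFunctor_comp_jordanFunctor (R : LinearAlgebraicGroup E G) {c d : ℂ}
    (hc : 2 * Real.pi * Complex.I * c = -1) (hcd : c + d = 0) :
    absorbFunctor R d ⋙ jordanFunctor R hc = 𝟭 (JCObj.{u} R) :=
  Functor.hext (jordanFunctor_obj_absorbFunctor_obj R hc hcd) fun X Y _ =>
    JCHom.heq_of_hom_eq (jordanFunctor_obj_absorbFunctor_obj R hc hcd X)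
      (jordanFunctor_obj_absorbFunctor_obj R hc hcd Y) HEq.rfl

end Functors

end LogRep

theorem mainTheorem3 {E : Type v} [NormedAddCommGroup E] [NormedSpace ℂ E]
    [FiniteDimensional ℂ E]
    {G : Type w} [Group G] [TopologicalSpace G] [ChartedSpace E G] [LieGroup 𝓘(ℂ, E) ω G]
    [ConnectedSpace G] (R : LogRep.LinearAlgebraicGroup E G) (hR : R.IsReductive) :
    ∃ (D : LogRep.RepObj.{u} E G ⥤ LogRep.JCObj.{u} R)
      (D' : LogRep.JCObj.{u} R ⥤ LogRep.RepObj.{u} E G),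
      -- `D` and `D'` are mutually inverse
      D ⋙ D' = 𝟭 (LogRep.RepObj.{u} E G) ∧ D' ⋙ D = 𝟭 (LogRep.JCObj.{u} R) ∧
      -- `D` is the identity on the underlying principal bundles and on morphisms
      D ⋙ LogRep.jcForget R = LogRep.repForget E G ∧
      -- `D (P, Φ) = (P, σ_Φ ∘ Φ, M_u)`, where `σ_Φ(t, z) = exp (-t/(2πi) log M_u(exp t * z))`
      (∀ (P : LogRep.PrincipalBundle.{u} E G) (Φ : LogRep.Representation P),
        ∃ (σ : LogRep.Cocycle Φ) (hss : LogRep.HasSemisimpleMonodromy R σ.twist)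
          (Mu : (⟨P, σ.twist⟩ : LogRep.RepObj.{u} E G) ≅ ⟨P, σ.twist⟩)
          (hMu : LogRep.IsUnipotentMap R Mu.hom.hom.toFun),
          LogRep.IsUnipotentPart R Φ.monodromy Mu.hom.hom.toFun ∧
          (∀ t : ℂ, LogRep.IsExpLogMap R (-t / (2 * Real.pi * Complex.I))
            Mu.hom.hom.toFun (σ.toFun t)) ∧
          D.obj ⟨P, Φ⟩ = ⟨⟨P, σ.twist⟩, hss, Mu, hMu⟩) ∧
      -- `D' (P, Ψ, U) = (P, τ_U ∘ Ψ)`, where `τ_U(t, z) = exp (t/(2πi) log U(exp t * z))`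
      (∀ (P : LogRep.PrincipalBundle.{u} E G) (Ψ : LogRep.Representation P)
        (hss : LogRep.HasSemisimpleMonodromy R Ψ)
        (U : (⟨P, Ψ⟩ : LogRep.RepObj.{u} E G) ≅ ⟨P, Ψ⟩)
        (hU : LogRep.IsUnipotentMap R U.hom.hom.toFun),
        ∃ τ : LogRep.Cocycle Ψ,
          (∀ t : ℂ, LogRep.IsExpLogMap R (t / (2 * Real.pi * Complex.I))
            U.hom.hom.toFun (τ.toFun t)) ∧
          D'.obj ⟨⟨P, Ψ⟩, hss, U, hU⟩ = ⟨P, τ.twist⟩) := by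
  have h2πi : (2 * Real.pi * Complex.I : ℂ) ≠ 0 := Complex.two_pi_I_ne_zero
  have hc : 2 * Real.pi * Complex.I * (-1 / (2 * Real.pi * Complex.I)) = (-1 : ℂ) :=
    mul_div_cancel₀ _ h2πi
  have hcd : -1 / (2 * Real.pi * Complex.I) + 1 / (2 * Real.pi * Complex.I) = (0 : ℂ) := by
    rw [← add_div, neg_add_cancel, zero_div]
  refine ⟨LogRep.jordanFunctor R hc, LogRep.absorbFunctor R (1 / (2 * Real.pi * Complex.I)),
    LogRep.jordanFunctor_comp_absorbFunctor R hc hcd,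
    LogRep.absorbFunctor_comp_jordanFunctor R hc hcd, rfl, fun P Φ => ?_, fun P Ψ hss U hU => ?_⟩
  · refine ⟨_, LogRep.UnipotentField.hasSemisimpleMonodromy_twist hc,
      ((LogRep.UnipotentField.ofMonodromy R Φ).twist _).aut,
      LogRep.UnipotentField.isUnipotentMap_aut _,
      LogRep.UnipotentField.isUnipotentPart_ofMonodromy, fun t => ?_, rfl⟩
    have h := (LogRep.UnipotentField.ofMonodromy R Φ).isExpLogMap_cocycle
      (-1 / (2 * Real.pi * Complex.I)) t
    rw [mul_div_assoc', mul_neg_one] at h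
    exact h
  · refine ⟨(LogRep.UnipotentField.ofAut U hU).cocycle _, fun t => ?_, rfl⟩
    have h := (LogRep.UnipotentField.ofAut U hU).isExpLogMap_cocycle
      (1 / (2 * Real.pi * Complex.I)) t
    rw [funext (LogRep.UnipotentField.smul_val_ofAut U hU), mul_one_div] at h
    exact h
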